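/- **Setting.** Let $c>0$, and let $\beta=\beta_2,\beta_3,\beta_4,\dots$, $\gamma,\epsilon,\gamma_3,\gamma_4,\dots$ be real constants. For $m>0$ ($m=GM/c^2$, with $M$ and $c$ fixed, so that powers of $m$ are powers of $G$) consider the static, spherically symmetric metric $ds^2=\mathcal A(r)(dx^0)^2-\mathcal B^{-1}(r)\,\delta_{ij}dx^idx^j$, $x^0=ct$, $r=|\boldsymbol x|$, $\boldsymbol x\in\mathbb R^3$, where $$\mathcal A(r)=1-\frac{2m}{r}+\sum_{n\ge2}\frac{(-1)^n n}{2^{n-2}}\beta_n\frac{m^n}{r^n},\qquad \mathcal B^{-1}(r)=1+2\gamma\frac mr+\frac32\epsilon\frac{m^2}{r^2}+\frac12\gamma_3\frac{m^3}{r^3}+\frac1{16}\gamma_4\frac{m^4}{r^4}+\sum_{n\ge5}(\gamma_n-1)\frac{m^n}{r^n}.$$ Assume that for some constant $\rho>0$ and for all $m>0$ both series converge to positive values for every $r>r_h:=\rho m$. Put $\mathcal U=1/(\mathcal A\mathcal B)$ and let $\kappa_n$ ($n\ge2$) be the constants defined by the expansion $\mathcal U(r)=1+2(1+\gamma)\frac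 mr+\sum_{n\ge2}2\kappa_n\frac{m^n}{r^n}$ in powers of $m/r$. The light rays are the null geodesics of the conformal metric $d\tilde s^2=\mathcal A^{-1}ds^2=(dx^0)^2-\mathcal U(r)\,\delta_{ij}dx^idx^j$. Let $\boldsymbol x_A\in\mathbb R^3$ and let $D\subset\mathbb R^3\setminus\{0\}$ be open and star-shaped with respect to $\boldsymbol x_A$. Write $\boldsymbol z(\xi)=\boldsymbol x_A+\xi(\boldsymbol x_B-\boldsymbol x_A)$. Assume that each $\boldsymbol x_B\in D$, $\boldsymbol x_B\ne\boldsymbol x_A$, is joined to $\boldsymbol x_A$ by a quasi-Minkowskian light ray: for all sufficiently small $m>0$ (how small may depend on $\boldsymbol x_B$) there is an affinely parametrized null geodesic of $d\tilde s^2$, lying in the region $r>r_h$, of the form $$x^0=ct_A+\xi|\boldsymbol x_B-\boldsymbol x_A|+\sum_{n\ge1}X^0_{(n)}(\boldsymbol x_A,\boldsymbol x_B,\xi),\qquad \boldsymbol x=\boldsymbol z(\xi)+\sum_{n\ge1}\boldsymbol X_{(n)}(\boldsymbol x_A,\boldsymbol x_B,\xi),\qquad 0\le\xi\le1,$$ where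 $X^0_{(n)}$ and $\boldsymbol X_{(n)}$ are of order $n$, that is, $m^n$ times a function independent of $m$; they are of class $C^2$ in $\xi$; the series may be differentiated twice term by term in $\xi$, with $C^2$ sums; and $X^0_{(n)}=0$ at $\xi=0$, $\boldsymbol X_{(n)}=\boldsymbol 0$ at $\xi=0$ and $\xi=1$. Let $\mathcal T^{(n)}(\boldsymbol x_A,\boldsymbol x_B)=\frac1cX^0_{(n)}(\boldsymbol x_A,\boldsymbol x_B,1)$ be the term of order $n$ in the resulting expansion of the time transfer function $t_B-t_A=\mathcal T(\boldsymbol x_A,\boldsymbol x_B)=\frac{|\boldsymbol x_B-\boldsymbol x_A|}{c}+\sum_{n\ge1}\mathcal T^{(n)}(\boldsymbol x_A,\boldsymbol x_B)$; being $m^n$ times a function independent of $m$, it is defined for every $m>0$. **Proposition.** For every $m>0$ and $n\ge1$ the function $\boldsymbol x\mapsto\mathcal T^{(n)}(\boldsymbol x_A,\boldsymbol x)$ is differentiable on $D\setminus\{\boldsymbol x_A\}$. Moreover, for every $\boldsymbol x_B\in D\setminus\{\boldsymbol x_A\}$ and $n\ge1$, $$\mathcal T^{(n)}(\boldsymbol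 x_A,\boldsymbol x_B)=\frac1c|\boldsymbol x_B-\boldsymbol x_A|\,F^{(n)}(\boldsymbol x_A,\boldsymbol x_B),$$ where the functions $F^{(n)}$ are determined by the recurrence relation $$F^{(1)}(\boldsymbol x_A,\boldsymbol x_B)=(1+\gamma)m\int_0^1\frac{d\xi}{|\boldsymbol z(\xi)|},$$ $$F^{(n)}(\boldsymbol x_A,\boldsymbol x_B)=\kappa_nm^n\int_0^1\frac{d\xi}{|\boldsymbol z(\xi)|^n}-\frac{c^2}{2}\sum_{p=1}^{n-1}\int_0^1\big[\nabla_{\boldsymbol x}\mathcal T^{(p)}(\boldsymbol x_A,\boldsymbol x)\cdot\nabla_{\boldsymbol x}\mathcal T^{(n-p)}(\boldsymbol x_A,\boldsymbol x)\big]_{\boldsymbol x=\boldsymbol z(\xi)}\,d\xi\qquad(n\ge2),$$ and all the integrands are integrable on $[0,1]$. -/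

import Mathlib

noncomputable section

namespace TimeTransfer

/-- Triples of spatial coordinates with the Euclidean norm and scalar product. -/
abbrev E3 : Type := EuclideanSpace ℝ (Fin 3)

/-- Events `(x⁰, 𝐱)`, `x⁰ = c t`, in the quasi-Cartesian coordinates. -/
abbrev Event : Type := ℝ × E3

/-- The generalized post-Newtonian parameters. `β n` is used for `n ≥ 2` only (`β 2` is the usual
parameter `β`), and `γ' n` is used for `n ≥ 3` only. -/
structure PNParameters where
  β : ℕ → ℝ
  γ : ℝ
  ε : ℝ
  γ' : ℕ → ℝ

namespace PNParameters

variable (P : PNParameters)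

/-- The coefficients of `𝒜(r) = 1 - 2 m/r + 2 β m²/r² - (3/2) β₃ m³/r³ + β₄ m⁴/r⁴ + ⋯` in powers of
`m/r`; for `n ≥ 2` the coefficient is `(-1)ⁿ n βₙ / 2ⁿ⁻²`. -/
def aCoeff : ℕ → ℝ
  | 0 => 1
  | 1 => -2
  | n + 2 => (-1) ^ (n + 2) * ((n + 2 : ℕ) : ℝ) / 2 ^ n * P.β (n + 2)

/-- The coefficients of
`ℬ⁻¹(r) = 1 + 2 γ m/r + (3/2) ε m²/r² + (1/2) γ₃ m³/r³ + (1/16) γ₄ m⁴/r⁴ + ∑_{n ≥ 5} (γₙ - 1) mⁿ/rⁿ`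
in powers of `m/r`. -/
def bCoeff : ℕ → ℝ
  | 0 => 1
  | 1 => 2 * P.γ
  | 2 => 3 / 2 * P.ε
  | 3 => 1 / 2 * P.γ' 3
  | 4 => 1 / 16 * P.γ' 4
  | n + 5 => P.γ' (n + 5) - 1

/-- The potential `𝒜(r)` of the metric with mass parameter `m`. -/
def potA (m r : ℝ) : ℝ := ∑' n : ℕ, P.aCoeff n * (m / r) ^ n

/-- The potential `ℬ⁻¹(r)` of the metric with mass parameter `m`. -/
def potBinv (m r : ℝ) : ℝ := ∑' n : ℕ, P.bCoeff n * (m / r) ^ n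

/-- The potential `𝒰(r) = 1 / (𝒜(r) ℬ(r))`. -/
def potU (m r : ℝ) : ℝ := P.potBinv m r / P.potA m r

/-- The metric is regular for `r > r_h`, where `r_h = ρ m`: there the expansions of `𝒜` and `ℬ⁻¹`
converge to positive functions. -/
def IsRegular (ρ : ℝ) : Prop :=
  0 < ρ ∧ ∀ m r : ℝ, 0 < m → ρ * m < r →
    Summable (fun n : ℕ => P.aCoeff n * (m / r) ^ n) ∧
    Summable (fun n : ℕ => P.bCoeff n * (m / r) ^ n) ∧
    0 < P.potA m r ∧ 0 < P.potBinv m r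

/-- The constants `κₙ` (`n ≥ 2`) in `𝒰(r) = 1 + 2 (1 + γ) m/r + ∑_{n ≥ 2} 2 κₙ mⁿ/rⁿ`. -/
def kappa (n : ℕ) : ℝ :=
  PowerSeries.coeff n (PowerSeries.mk P.bCoeff * (PowerSeries.mk P.aCoeff)⁻¹) / 2

end PNParameters

/-- The metric `ds̃² = (dx⁰)² - 𝒰(r) δᵢⱼ dxⁱ dxʲ`, at the event `y` and for the vectors `v`, `w`. -/
def conformalMetric (U : ℝ → ℝ) (y v w : Event) : ℝ :=
  v.1 * w.1 - U ‖y.2‖ * inner ℝ v.2 w.2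

/-- `x : [0, 1] → Event` is a null geodesic of the metric `g`, affinely parametrized. The geodesic
equation is written in its covariant form
`d/dξ (g_{αβ} x'^β) = (1/2) (∂_α g_{βσ}) x'^β x'^σ`, contracted with an arbitrary constant `w^α`. -/
def IsNullGeodesic (g : Event → Event → Event → ℝ) (x : ℝ → Event) : Prop :=
  ∃ v : ℝ → Event, ∀ ξ ∈ Set.Icc (0 : ℝ) 1,
    HasDerivWithinAt x (v ξ) (Set.Icc 0 1) ξ ∧
    v ξ ≠ 0 ∧
    g (x ξ) (v ξ) (v ξ) = 0 ∧
    ∀ w : Event, HasDerivWithinAt (fun s => g (x s) (v s) w)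
      (1 / 2 * fderiv ℝ (fun y => g y (v ξ) (v ξ)) (x ξ) w) (Set.Icc 0 1) ξ

/-- On `[0, 1]`, `f = ∑_{n ≥ 1} mⁿ Y n`, where the terms are of class `C²` and the series may be
differentiated term by term up to the second order. -/
def HasExpansion {V : Type} [NormedAddCommGroup V] [NormedSpace ℝ V]
    (m : ℝ) (Y : ℕ → ℝ → V) (f : ℝ → V) : Prop :=
  (∀ n : ℕ, 1 ≤ n → ContDiffOn ℝ 2 (Y n) (Set.Icc 0 1)) ∧
  ContDiffOn ℝ 2 f (Set.Icc 0 1) ∧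
  ∀ k : ℕ, k ≤ 2 → ∀ ξ ∈ Set.Icc (0 : ℝ) 1,
    HasSum (fun n : ℕ => m ^ (n + 1) • iteratedDerivWithin k (Y (n + 1)) (Set.Icc 0 1) ξ)
      (iteratedDerivWithin k f (Set.Icc 0 1) ξ)

/-- The point `𝐳(ξ) = 𝐱_A + ξ (𝐱_B - 𝐱_A)` of the straight segment. -/
def seg (xA xB : E3) (ξ : ℝ) : E3 := xA + ξ • (xB - xA)

/-- `mⁿ X0 n` and `mⁿ X n` (`n ≥ 1`) are the terms of order `n` of the quasi-Minkowskian light ray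
emitted at `xA` at the time `tA` and received at `xB`: for all sufficiently small values of the mass
parameter `m = G M / c²`, the curve
`x⁰ = c tA + ξ |xB - xA| + ∑ mⁿ X0 n ξ`, `𝐱 = 𝐳(ξ) + ∑ mⁿ X n ξ`, `0 ≤ ξ ≤ 1`,
is a null geodesic entirely lying in the region `r > r_h = ρ m`. -/
def IsQuasiMinkowskianRay (P : PNParameters) (ρ c tA : ℝ) (xA xB : E3)
    (X0 : ℕ → ℝ → ℝ) (X : ℕ → ℝ → E3) : Prop :=
  (∀ n : ℕ, 1 ≤ n → X0 n 0 = 0 ∧ X n 0 = 0 ∧ X n 1 = 0) ∧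
  ∃ m₀ : ℝ, 0 < m₀ ∧ ∀ m : ℝ, 0 < m → m < m₀ →
    ∃ (x0 : ℝ → ℝ) (x : ℝ → E3),
      HasExpansion m X0 (fun ξ => x0 ξ - (c * tA + ξ * ‖xB - xA‖)) ∧
      HasExpansion m X (fun ξ => x ξ - seg xA xB ξ) ∧
      (∀ ξ ∈ Set.Icc (0 : ℝ) 1, ρ * m < ‖x ξ‖) ∧
      IsNullGeodesic (conformalMetric (P.potU m)) (fun ξ => (x0 ξ, x ξ))

/-- The term `𝒯⁽ⁿ⁾` of order `n`, as a function of the point of reception, in the expansion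
`t_B - t_A = |𝐱_B - 𝐱_A| / c + ∑_{n ≥ 1} 𝒯⁽ⁿ⁾(𝐱_A, 𝐱_B)` of the time transfer function; it comes from
the expansion of `x⁰ = c t` at `ξ = 1`. -/
def timeTransferTerm (c m : ℝ) (X0 : ℕ → E3 → ℝ → ℝ) (n : ℕ) (xB : E3) : ℝ :=
  m ^ n * X0 n xB 1 / c

end TimeTransfer

end

/-! Write `a` for the emission point. The optical length `φ(x)` from `a` should solve the eikonal
equation `|∇φ|² = 𝒰`. Inserting `φ = ‖x - a‖ ∑ mⁿ Fₙ` and comparing powers of `m` gives `Fₙ + (x -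
a)·∇Fₙ = (source built from F₁, …, Fₙ₋₁)`, which integration along the segment from `a` solves. This
is the recurrence of the proposition, and its solutions `eikonalTerm` are smooth on `D`, the point
`a` included.

It remains to identify these `Fₙ` with the coefficients of the given rays, about which no regularity
in the reception point is assumed. Truncate at order `N` and put `Ω = ½ ‖x - a‖² (∑ mⁿ Fₙ)²`, which
unlike `φ` is smooth at `a`. Its gradient `W` satisfies `|W|² = 2Ω𝒰 + O(m^(N+1))`
(`norm_gradient_worldFunction_sq_eq`). Along a ray with velocity `v` and `e = x⁰(1) - x⁰(0)`, the
geodesic equation gives `(𝒰v)' = ½|v|²∇𝒰` and `e² = 𝒰|v|²`. For an exact solution one expects `ξ𝒰v =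
W`. The difference of the two sides vanishes at `ξ = 0` and obeys a linear differential inequality,
singular there, with forcing `O(m^(N+1))`. Hence `½e² = Ω(x_B) + O(m^(N+1))` (`abs_energy_sub_le`).

The estimate needs the ray to stay near the segment, where all bounds are uniform in `m`; a
continuity argument gives this from the initial velocity alone (`norm_sub_segment_lt`). Taking the
square root, `e = ‖x_B - a‖ ∑_{n ≤ N} mⁿ Fₙ(x_B) + O(m^(N+1))`, and comparison of coefficients
(`IsQuasiMinkowskianRay.time_term_eq`) identifies the transfer terms. Their differentiability and
the recurrence are then read off from `eikonalTerm`. -/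

noncomputable section

namespace TimeTransfer

open Set Filter Topology MeasureTheory
open scoped ContDiff

/-! ### Averages over segments issued from a point: smoothness and the transport equation. -/

section SegmentIntegral

variable {E V : Type} [NormedAddCommGroup E] [NormedSpace ℝ E]
  [NormedAddCommGroup V] [NormedSpace ℝ V]

theorem starConvex_lineMap_mem {a x : E} {D : Set E} (hD : StarConvex ℝ a D) (hx : x ∈ D)
    {ξ : ℝ} (hξ : ξ ∈ Icc (0 : ℝ) 1) : a + ξ • (x - a) ∈ D :=
  hD.add_smul_sub_mem hx hξ.1 hξ.2

variable [ProperSpace E]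

/-- The weight `ξ ^ k` closes this family of integrals under differentiation: the chain rule
produces one more factor `ξ`. Domination comes from compactness of `[0, 1]` times a closed ball,
which the segments map into `D`. -/
theorem hasFDerivAt_segment_integral {a : E} {D : Set E} (hDo : IsOpen D) (hD : StarConvex ℝ a D)
    {G : E → V} (hG : ContDiffOn ℝ ∞ G D) (k : ℕ) {x : E} (hx : x ∈ D) :
    HasFDerivAt (fun y => ∫ ξ in (0 : ℝ)..1, ξ ^ k • G (a + ξ • (y - a)))
      (∫ ξ in (0 : ℝ)..1, ξ ^ (k + 1) • fderiv ℝ G (a + ξ • (x - a))) x := by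
  obtain ⟨ε, hε, hball⟩ := Metric.nhds_basis_closedBall.mem_iff.1 (hDo.mem_nhds hx)
  have hG' : ContinuousOn (fderiv ℝ G) D := hG.continuousOn_fderiv_of_isOpen hDo (by simp)
  have hline : Continuous (fun q : ℝ × E => a + q.1 • (q.2 - a)) := by fun_prop
  have hmaps : MapsTo (fun q : ℝ × E => a + q.1 • (q.2 - a)) (Icc 0 1 ×ˢ Metric.closedBall x ε) D :=
    fun q hq => starConvex_lineMap_mem hD (hball hq.2) hq.1
  have hcont : ContinuousOn
      (fun q : ℝ × E => q.1 ^ (k + 1) • fderiv ℝ G (a + q.1 • (q.2 - a)))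
      (Icc 0 1 ×ˢ Metric.closedBall x ε) :=
    (by fun_prop : Continuous fun q : ℝ × E => q.1 ^ (k + 1)).continuousOn.smul
      (hG'.comp hline.continuousOn hmaps)
  obtain ⟨C, hC⟩ := (isCompact_Icc.prod (isCompact_closedBall x ε)).exists_bound_of_continuousOn hcont
  have hGc : ∀ y ∈ D, ContinuousOn (fun ξ : ℝ => ξ ^ k • G (a + ξ • (y - a))) (uIcc 0 1) := by
    intro y hy
    rw [uIcc_of_le zero_le_one]
    refine (by fun_prop : Continuous fun ξ : ℝ => ξ ^ k).continuousOn.smul ?_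
    exact hG.continuousOn.comp (by fun_prop) fun ξ hξ => starConvex_lineMap_mem hD hy hξ
  have hIoc : uIoc (0 : ℝ) 1 ⊆ Icc 0 1 := by
    rw [uIoc_of_le zero_le_one]; exact Ioc_subset_Icc_self
  refine intervalIntegral.hasFDerivAt_integral_of_dominated_of_fderiv_le (𝕜 := ℝ)
    (F := fun y ξ => ξ ^ k • G (a + ξ • (y - a)))
    (F' := fun y ξ => ξ ^ (k + 1) • fderiv ℝ G (a + ξ • (y - a)))
    (bound := fun _ => C) (s := Metric.closedBall x ε) (Metric.closedBall_mem_nhds x hε)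
    ?_ ((hGc x hx).intervalIntegrable) ?_ ?_ intervalIntegrable_const ?_
  · filter_upwards [hDo.mem_nhds hx] with y hy
    exact (intervalIntegrable_iff.1 (hGc y hy).intervalIntegrable).aestronglyMeasurable
  · have : ContinuousOn (fun ξ : ℝ => ξ ^ (k + 1) • fderiv ℝ G (a + ξ • (x - a))) (uIcc 0 1) := by
      rw [uIcc_of_le zero_le_one]
      exact hcont.comp (f := fun ξ : ℝ => (ξ, x)) (by fun_prop)
        fun ξ hξ => ⟨hξ, Metric.mem_closedBall_self hε.le⟩
    exact (intervalIntegrable_iff.1 this.intervalIntegrable).aestronglyMeasurable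
  · exact ae_of_all _ fun ξ hξ y hy => hC (ξ, y) ⟨hIoc hξ, hy⟩
  · refine ae_of_all _ fun ξ hξ y hy => ?_
    have h1 : HasFDerivAt G (fderiv ℝ G (a + ξ • (y - a))) (a + ξ • (y - a)) :=
      ((hG.differentiableOn (by simp)).differentiableAt
        (hDo.mem_nhds (starConvex_lineMap_mem hD (hball hy) (hIoc hξ)))).hasFDerivAt
    have h2 : HasFDerivAt (fun y : E => a + ξ • (y - a)) (ξ • ContinuousLinearMap.id ℝ E) y :=
      (((hasFDerivAt_id y).sub_const a).const_smul ξ).const_add a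
    have h3 := (h1.comp y h2).const_smul (ξ ^ k)
    refine h3.congr_fderiv ?_
    ext w
    simp [pow_succ, mul_smul]

variable [CompleteSpace V]

theorem contDiffOn_segment_integral {a : E} {D : Set E} (hDo : IsOpen D) (hD : StarConvex ℝ a D)
    {G : E → V} (hG : ContDiffOn ℝ ∞ G D) :
    ContDiffOn ℝ ∞ (fun y => ∫ ξ in (0 : ℝ)..1, G (a + ξ • (y - a))) D := by
  -- The weight and the target space must vary in the induction: the derivative is an integral with
  -- weight `k + 1` and values in `E →L[ℝ] W`.
  suffices h : ∀ (n k : ℕ) (W : Type) [NormedAddCommGroup W] [NormedSpace ℝ W] [CompleteSpace W]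
      (H : E → W), ContDiffOn ℝ ∞ H D →
      ContDiffOn ℝ n (fun y => ∫ ξ in (0 : ℝ)..1, ξ ^ k • H (a + ξ • (y - a))) D by
    refine contDiffOn_infty.2 fun n => ?_
    simpa using h n 0 V G hG
  intro n
  induction n with
  | zero =>
    intro k W _ _ _ H hH
    exact contDiffOn_zero.2 fun x hx =>
      (hasFDerivAt_segment_integral hDo hD hH k hx).continuousAt.continuousWithinAt
  | succ n ih =>
    intro k W _ _ _ H hH
    push_cast
    rw [contDiffOn_succ_iff_fderiv_of_isOpen hDo]
    refine ⟨fun x hx => (hasFDerivAt_segment_integral hDo hD hH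
      k hx).differentiableAt.differentiableWithinAt, by simp, ?_⟩
    refine (ih (k + 1) _ (fderiv ℝ H) (hH.fderiv_of_isOpen hDo (by simp))).congr fun x hx => ?_
    exact (hasFDerivAt_segment_integral hDo hD hH k hx).fderiv

/-- The segment average `f` of `G` satisfies `f + (x - a) · ∇ f = G`. -/
theorem segment_integral_add_fderiv {a : E} {D : Set E} (hDo : IsOpen D) (hD : StarConvex ℝ a D)
    {G : E → V} (hG : ContDiffOn ℝ ∞ G D) {x : E} (hx : x ∈ D) :
    (∫ ξ in (0 : ℝ)..1, G (a + ξ • (x - a))) +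
      fderiv ℝ (fun y => ∫ ξ in (0 : ℝ)..1, G (a + ξ • (y - a))) x (x - a) = G x := by
  have hmem : ∀ ξ ∈ Icc (0 : ℝ) 1, a + ξ • (x - a) ∈ D :=
    fun ξ hξ => starConvex_lineMap_mem hD hx hξ
  have hF := hasFDerivAt_segment_integral hDo hD hG 0 hx
  simp only [pow_zero, one_smul] at hF
  rw [hF.fderiv]
  have hG' : ContinuousOn (fderiv ℝ G) D := hG.continuousOn_fderiv_of_isOpen hDo (by simp)
  have hc : ContinuousOn (fun ξ : ℝ => a + ξ • (x - a)) (uIcc 0 1) := by fun_prop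
  have hmaps : MapsTo (fun ξ : ℝ => a + ξ • (x - a)) (uIcc 0 1) D := by
    rw [uIcc_of_le zero_le_one]; exact hmem
  have hc0 : ContinuousOn (fun ξ : ℝ => G (a + ξ • (x - a))) (uIcc 0 1) :=
    hG.continuousOn.comp hc hmaps
  have hc1 : ContinuousOn (fun ξ : ℝ => ξ ^ (0 + 1) • fderiv ℝ G (a + ξ • (x - a))) (uIcc 0 1) :=
    (by fun_prop : Continuous fun ξ : ℝ => ξ ^ (0 + 1)).continuousOn.smul (hG'.comp hc hmaps)
  rw [ContinuousLinearMap.intervalIntegral_apply hc1.intervalIntegrable]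
  rw [← intervalIntegral.integral_add hc0.intervalIntegrable
    (hc1.clm_apply continuousOn_const).intervalIntegrable]
  -- The two integrands add up to the derivative of `ξ G(a + ξ (x - a))`, whose increment over `[0,
  -- 1]` is `G x`.
  have hder : ∀ ξ ∈ uIcc (0 : ℝ) 1, HasDerivAt (fun ξ : ℝ => ξ • G (a + ξ • (x - a)))
      (G (a + ξ • (x - a)) + (ξ ^ (0 + 1) • fderiv ℝ G (a + ξ • (x - a))) (x - a)) ξ := by
    intro ξ hξ
    have h1 : HasFDerivAt G (fderiv ℝ G (a + ξ • (x - a))) (a + ξ • (x - a)) :=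
      ((hG.differentiableOn (by simp)).differentiableAt (hDo.mem_nhds (hmaps hξ))).hasFDerivAt
    have h2 : HasDerivAt (fun ξ : ℝ => a + ξ • (x - a)) (x - a) ξ := by
      simpa using ((hasDerivAt_id ξ).smul_const (x - a)).const_add a
    have h3 := (hasDerivAt_id ξ).smul (h1.comp_hasDerivAt ξ h2)
    refine h3.congr_deriv ?_
    simp [add_comm]
  rw [intervalIntegral.integral_eq_sub_of_hasDerivAt hder
    (hc0.add (hc1.clm_apply continuousOn_const)).intervalIntegrable]
  simp

end SegmentIntegral

/-! ### Bounds uniform on compact sets for families depending smoothly on `m`. -/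

section UniformBounds

variable {E V : Type} [NormedAddCommGroup E] [NormedSpace ℝ E]
  [NormedAddCommGroup V] [NormedSpace ℝ V]

/-- The partial derivative with respect to the second variable. -/
def partialSnd (f : ℝ → E → V) (m : ℝ) (x : E) : E →L[ℝ] V := fderiv ℝ (f m) x

theorem contDiffOn_partialSnd {f : ℝ → E → V} {O : Set (ℝ × E)} (hO : IsOpen O)
    (hf : ContDiffOn ℝ ∞ (Function.uncurry f) O) :
    ContDiffOn ℝ ∞ (Function.uncurry (partialSnd f)) O := by
  intro q hq
  refine ContDiffAt.contDiffWithinAt ?_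
  have h := ContDiffAt.fderiv (𝕜 := ℝ) (n := ∞) (m := ∞) (x₀ := q)
    (f := fun (p : ℝ × E) (y : E) => f p.1 y) (g := fun p => p.2) ?_ contDiffAt_snd (by simp)
  · exact h
  · have : ContDiffAt ℝ ∞ (Function.uncurry f) ((fun r : (ℝ × E) × E => (r.1.1, r.2)) (q, q.2)) :=
      hf.contDiffAt (hO.mem_nhds hq)
    exact ContDiffAt.comp (f := fun r : (ℝ × E) × E => (r.1.1, r.2)) (q, q.2) this (by fun_prop)

theorem exists_norm_le_of_contDiffOn {f : ℝ → E → V} {O : Set (ℝ × E)} {K : Set E} {m₁ : ℝ}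
    (hK : IsCompact K) (hO : Icc 0 m₁ ×ˢ K ⊆ O) (hf : ContDiffOn ℝ ∞ (Function.uncurry f) O) :
    ∃ C : ℝ, 0 ≤ C ∧ ∀ m ∈ Icc 0 m₁, ∀ x ∈ K, ‖f m x‖ ≤ C := by
  obtain ⟨C, hC⟩ := (isCompact_Icc.prod hK).exists_bound_of_continuousOn (hf.continuousOn.mono hO)
  exact ⟨max C 0, le_max_right _ _, fun m hm x hx => (hC (m, x) ⟨hm, hx⟩).trans (le_max_left _ _)⟩

/-- Mean value inequality in `m` at fixed `x`, with the `m`-derivative bounded by compactness. It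
measures deviations from the flat case `m = 0`. -/
theorem exists_norm_sub_le_mul_of_contDiffOn {f : ℝ → E → V} {O : Set (ℝ × E)} {K : Set E} {m₁ : ℝ}
    (hK : IsCompact K) (hOo : IsOpen O) (hO : Icc 0 m₁ ×ˢ K ⊆ O)
    (hf : ContDiffOn ℝ ∞ (Function.uncurry f) O) :
    ∃ C : ℝ, 0 ≤ C ∧ ∀ m ∈ Icc 0 m₁, ∀ x ∈ K, ‖f m x - f 0 x‖ ≤ C * m := by
  have hf' : ContinuousOn (fderiv ℝ (Function.uncurry f)) O :=
    hf.continuousOn_fderiv_of_isOpen hOo (by simp)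
  obtain ⟨C, hC⟩ := (isCompact_Icc.prod hK).exists_bound_of_continuousOn (hf'.mono hO)
  refine ⟨max C 0, le_max_right _ _, fun m hm x hx => ?_⟩
  have key : ∀ s ∈ Icc 0 m, HasDerivWithinAt (fun s => f s x)
      (fderiv ℝ (Function.uncurry f) (s, x) (1, 0)) (Icc 0 m) s := by
    intro s hs
    have h1 : HasFDerivAt (Function.uncurry f) (fderiv ℝ (Function.uncurry f) (s, x)) (s, x) :=
      ((hf.differentiableOn (by simp)).differentiableAt
        (hOo.mem_nhds (hO ⟨⟨hs.1, hs.2.trans hm.2⟩, hx⟩))).hasFDerivAt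
    have h2 : HasDerivAt (fun s : ℝ => (s, x)) ((1 : ℝ), (0 : E)) s :=
      (hasDerivAt_id s).prodMk (hasDerivAt_const s x)
    exact (h1.comp_hasDerivAt s h2).hasDerivWithinAt
  have := norm_image_sub_le_of_norm_deriv_le_segment' (C := max C 0) key (fun s hs => ?_) m
    ⟨hm.1, le_rfl⟩
  · simpa using this
  · have hsC := hC (s, x) ⟨⟨hs.1, hs.2.le.trans hm.2⟩, hx⟩
    refine (ContinuousLinearMap.le_opNorm _ _).trans ?_
    have : ‖((1 : ℝ), (0 : E))‖ = 1 := by simp [Prod.norm_def]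
    rw [this, mul_one]
    exact hsC.trans (le_max_left _ _)

end UniformBounds

/-! ### Remainders and coefficients of power series in `m`. -/

section PowerSeriesBounds

variable {V : Type} [NormedAddCommGroup V] [NormedSpace ℝ V]

/-- Convergence at the single value `m₁` bounds every term there, so for `m ≤ m₁ / 2` the tail is
dominated by a geometric series of ratio `1/2`, with a constant independent of `m`. -/
theorem exists_norm_sub_sum_le_of_hasSum [FiniteDimensional ℝ V] {a : ℕ → V} {m₁ : ℝ}
    (hm₁ : 0 < m₁) (hs : Summable fun n : ℕ => m₁ ^ (n + 1) • a n) (N : ℕ) :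
    ∃ C : ℝ, 0 ≤ C ∧ ∀ m : ℝ, 0 < m → m ≤ m₁ / 2 → ∀ s : V,
      HasSum (fun n : ℕ => m ^ (n + 1) • a n) s →
      ‖s - ∑ n ∈ Finset.range N, m ^ (n + 1) • a n‖ ≤ C * m ^ (N + 1) := by
  have : CompleteSpace V := FiniteDimensional.complete ℝ V
  obtain ⟨B, hB⟩ := hs.tendsto_atTop_zero.norm.bddAbove_range
  have hB' : ∀ n : ℕ, ‖a n‖ ≤ B / m₁ ^ (n + 1) := by
    intro n
    have h := hB ⟨n, rfl⟩
    simp only [norm_smul, norm_pow, Real.norm_eq_abs, abs_of_pos hm₁] at h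
    rw [le_div_iff₀ (by positivity)]
    linarith
  have hB0 : 0 ≤ B := le_trans (norm_nonneg _) (hB ⟨0, rfl⟩)
  refine ⟨B / m₁ ^ (N + 1) * 2, by positivity, fun m hm hmm s hsum => ?_⟩
  have htail := ((hasSum_nat_add_iff' N).2 hsum)
  have hgeo : HasSum (fun n : ℕ => B / m₁ ^ (N + 1) * m ^ (N + 1) * (1 / 2 : ℝ) ^ n)
      (B / m₁ ^ (N + 1) * m ^ (N + 1) * 2) := hasSum_geometric_two.mul_left _
  have hle : ∀ n : ℕ, ‖m ^ (n + N + 1) • a (n + N)‖ ≤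
      B / m₁ ^ (N + 1) * m ^ (N + 1) * (1 / 2 : ℝ) ^ n := by
    intro n
    rw [norm_smul, norm_pow, Real.norm_eq_abs, abs_of_pos hm]
    calc m ^ (n + N + 1) * ‖a (n + N)‖ ≤ m ^ (n + N + 1) * (B / m₁ ^ (n + N + 1)) := by
          gcongr; exact hB' _
      _ = B / m₁ ^ (N + 1) * m ^ (N + 1) * (m / m₁) ^ n := by
          rw [div_pow]; field_simp; ring
      _ ≤ _ := by
          have : m / m₁ ≤ 1 / 2 := by rw [div_le_iff₀ hm₁]; linarith
          gcongr
  have := tsum_of_norm_bounded hgeo hle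
  rw [htail.tsum_eq] at this
  linarith

theorem eq_zero_of_norm_pow_smul_le {a : V} {n : ℕ} {C : ℝ}
    (h : ∀ᶠ m : ℝ in 𝓝[>] 0, ‖m ^ n • a‖ ≤ C * m ^ (n + 1)) : a = 0 := by
  have hlim : Tendsto (fun m : ℝ => C * m) (𝓝[>] 0) (𝓝 0) := by
    have : Tendsto (fun m : ℝ => C * m) (𝓝 0) (𝓝 (C * 0)) :=
      (continuous_const.mul continuous_id).tendsto 0
    rw [mul_zero] at this
    exact this.mono_left nhdsWithin_le_nhds
  have : ‖a‖ ≤ 0 := by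
    refine ge_of_tendsto hlim ?_
    filter_upwards [h, self_mem_nhdsWithin] with m hm hm0
    have hm0' : 0 < m := hm0
    rw [norm_smul, norm_pow, Real.norm_eq_abs, abs_of_pos hm0'] at hm
    refine le_of_mul_le_mul_left (a := m ^ n) ?_ (by positivity)
    calc _ ≤ _ := hm
      _ = _ := by ring
  simpa using this

theorem eventually_mul_lt (A : ℝ) {B : ℝ} (hB : 0 < B) : ∀ᶠ m : ℝ in 𝓝[>] 0, A * m < B := by
  have : Tendsto (fun m : ℝ => A * m) (𝓝 0) (𝓝 (A * 0)) :=
    (continuous_const.mul continuous_id).tendsto 0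
  rw [mul_zero] at this
  exact (this.mono_left nhdsWithin_le_nhds).eventually (gt_mem_nhds hB)

end PowerSeriesBounds

/-! ### Estimates along a ray: closeness to the segment and comparison with the eikonal field. -/

section RayEstimates

variable {E : Type} [NormedAddCommGroup E] [InnerProductSpace ℝ E]

/-- The inequality is singular at `0`: for `μ = 0` it admits multiples of `√ξ`, so `η 0 = 0` does
not suffice. The bounded derivative excludes them by giving `‖η ξ‖ ≤ K ξ`. Feeding a bound `q ξ`
back into the inequality and integrating improves `q` to `q / 2 + μ`, and the iterates converge to
the fixed point `2 μ`. -/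
theorem norm_le_mul_of_norm_smul_deriv_le {η η' : ℝ → E} {K μ : ℝ}
    (hη : ∀ ξ ∈ Icc (0 : ℝ) 1, HasDerivWithinAt η (η' ξ) (Icc 0 1) ξ) (h0 : η 0 = 0)
    (hK : ∀ ξ ∈ Icc (0 : ℝ) 1, ‖η' ξ‖ ≤ K)
    (hle : ∀ ξ ∈ Icc (0 : ℝ) 1, ‖ξ • η' ξ‖ ≤ 1 / 2 * ‖η ξ‖ + μ * ξ) :
    ∀ ξ ∈ Icc (0 : ℝ) 1, ‖η ξ‖ ≤ 2 * μ * ξ := by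
  have hstep : ∀ q : ℝ, (∀ ξ ∈ Icc (0 : ℝ) 1, ‖η ξ‖ ≤ q * ξ) →
      ∀ ξ ∈ Icc (0 : ℝ) 1, ‖η ξ‖ ≤ (q / 2 + μ) * ξ := by
    intro q hq ξ hξ
    rcases hξ.1.eq_or_lt with h | hpos
    · rw [← h, h0]; simp
    have hder : ∀ s ∈ Ioc (0 : ℝ) 1, ‖η' s‖ ≤ q / 2 + μ := by
      intro s hs
      have h1 := hle s ⟨hs.1.le, hs.2⟩
      have h2 := hq s ⟨hs.1.le, hs.2⟩
      rw [norm_smul, Real.norm_eq_abs, abs_of_pos hs.1] at h1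
      refine le_of_mul_le_mul_left (a := s) ?_ hs.1
      nlinarith
    have hc0 : 0 ≤ q / 2 + μ := (norm_nonneg _).trans (hder ξ ⟨hpos, hξ.2⟩)
    have hq0 : 0 ≤ q := by
      have := (norm_nonneg _).trans (hq ξ hξ)
      exact nonneg_of_mul_nonneg_left this hpos
    -- At `ξ = 0` the inequality says nothing about `η'`, so integration starts at a small `a > 0`,
    -- where the old bound makes `‖η a‖ ≤ t`.
    refine le_of_forall_pos_le_add fun t ht => ?_
    obtain ⟨a, ha0, haξ, hat⟩ : ∃ a : ℝ, 0 < a ∧ a ≤ ξ ∧ q * a ≤ t := by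
      refine ⟨min ξ (t / (q + 1)), by positivity, min_le_left _ _, ?_⟩
      calc q * min ξ (t / (q + 1)) ≤ q * (t / (q + 1)) := by gcongr; exact min_le_right _ _
        _ = q / (q + 1) * t := by ring
        _ ≤ 1 * t := by gcongr; rw [div_le_one (by positivity)]; linarith
        _ = t := one_mul t
    have hsub : Icc a ξ ⊆ Icc (0 : ℝ) 1 := Icc_subset_Icc ha0.le hξ.2
    have := norm_image_sub_le_of_norm_deriv_le_segment' (f := η) (f' := η') (C := q / 2 + μ)
      (a := a) (b := ξ) (fun s hs => (hη s (hsub hs)).mono hsub)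
      (fun s hs => hder s ⟨ha0.trans_le hs.1, hs.2.le.trans hξ.2⟩) ξ ⟨haξ, le_rfl⟩
    have ha := hq a ⟨ha0.le, haξ.trans hξ.2⟩
    have htri : ‖η ξ‖ ≤ ‖η ξ - η a‖ + ‖η a‖ := by
      simpa using norm_add_le (η ξ - η a) (η a)
    nlinarith
  have hbase : ∀ ξ ∈ Icc (0 : ℝ) 1, ‖η ξ‖ ≤ K * ξ := by
    intro ξ hξ
    have := norm_image_sub_le_of_norm_deriv_le_segment' (f := η) (f' := η') (C := K)
      (a := 0) (b := 1) hη (fun s hs => hK s (Ico_subset_Icc_self hs)) ξ hξ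
    simpa [h0] using this
  have hiter : ∀ i : ℕ, ∀ ξ ∈ Icc (0 : ℝ) 1, ‖η ξ‖ ≤ (K * (1 / 2) ^ i + 2 * μ * (1 - (1 / 2) ^ i)) * ξ := by
    intro i
    induction i with
    | zero => simpa using hbase
    | succ i ih =>
      intro ξ hξ
      have := hstep _ ih ξ hξ
      calc _ ≤ _ := this
        _ = _ := by ring
  intro ξ hξ
  have hpow : Tendsto (fun i : ℕ => (1 / 2 : ℝ) ^ i) atTop (𝓝 0) :=
    tendsto_pow_atTop_nhds_zero_of_lt_one (by norm_num) (by norm_num)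
  have hlim : Tendsto (fun i : ℕ => (K * (1 / 2) ^ i + 2 * μ * (1 - (1 / 2) ^ i)) * ξ) atTop
      (𝓝 ((K * 0 + 2 * μ * (1 - 0)) * ξ)) :=
    ((hpow.const_mul K).add ((tendsto_const_nhds.sub hpow).const_mul (2 * μ))).mul_const ξ
  have := ge_of_tendsto' hlim fun i => hiter i ξ hξ
  simpa using this

/-- A ray whose momentum varies slowly stays close to the straight segment. -/
theorem norm_sub_segment_lt {x v : ℝ → E} {U : E → ℝ} {g : E → E} {a w : E} {e C ε δ : ℝ}
    (hx : ∀ ξ ∈ Icc (0 : ℝ) 1, HasDerivWithinAt x (v ξ) (Icc 0 1) ξ)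
    (hP : ∀ ξ ∈ Icc (0 : ℝ) 1, HasDerivWithinAt (fun s => U (x s) • v s)
      ((1 / 2 * ‖v ξ‖ ^ 2) • g (x ξ)) (Icc 0 1) ξ)
    (hnull : ∀ ξ ∈ Icc (0 : ℝ) 1, e ^ 2 = U (x ξ) * ‖v ξ‖ ^ 2)
    (hU : ∀ y, ∀ ξ ∈ Icc (0 : ℝ) 1, ‖y - (a + ξ • w)‖ ≤ δ →
      1 / 2 ≤ U y ∧ |U y - 1| ≤ C * ε ∧ ‖g y‖ ≤ C * ε)
    (hδ : 0 < δ) (hx0 : x 0 = a) (he : 0 ≤ e) (hv0 : ‖v 0 - w‖ ≤ C * ε)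
    (hsmall : C * ε * (e ^ 2 + 4 * e + 1) < δ) :
    ∀ ξ ∈ Icc (0 : ℝ) 1, ‖x ξ - (a + ξ • w)‖ < δ := by
  have hCε : 0 ≤ C * ε := (norm_nonneg _).trans hv0
  have hd : ContinuousOn (fun ξ => ‖x ξ - (a + ξ • w)‖) (Icc 0 1) := by
    have : ContinuousOn x (Icc 0 1) := fun ξ hξ => (hx ξ hξ).continuousWithinAt
    fun_prop
  have hv : ∀ ξ ∈ Icc (0 : ℝ) 1, 1 / 2 ≤ U (x ξ) → ‖v ξ‖ ^ 2 ≤ 2 * e ^ 2 ∧ ‖v ξ‖ ≤ 2 * e := by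
    intro ξ hξ h
    have h1 := hnull ξ hξ
    have h2 : ‖v ξ‖ ^ 2 ≤ 2 * e ^ 2 := by nlinarith [sq_nonneg ‖v ξ‖]
    exact ⟨h2, abs_le_of_sq_le_sq' (by nlinarith [sq_nonneg e]) (by positivity) |>.2⟩
  -- Otherwise there is a first time `s` at distance at least `δ`. Up to `s` the bounds on `U` and
  -- `g` apply, so the velocity is close to `w`; integrating yields a distance below `δ` at `s`.
  by_contra! hcon
  have hclosed : IsCompact {ξ ∈ Icc (0 : ℝ) 1 | δ ≤ ‖x ξ - (a + ξ • w)‖} :=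
    (isCompact_Icc.of_isClosed_subset
      (hd.preimage_isClosed_of_isClosed isClosed_Icc isClosed_Ici) fun _ h => h.1)
  obtain ⟨s, ⟨hs, hsδ⟩, hmin⟩ := hclosed.exists_isLeast
    (let ⟨ξ, hξ, h⟩ := hcon; ⟨ξ, hξ, h⟩)
  have hlt : ∀ ξ ∈ Ico (0 : ℝ) s, ‖x ξ - (a + ξ • w)‖ ≤ δ := by
    intro ξ hξ
    by_contra! h
    exact absurd (hmin ⟨⟨hξ.1, hξ.2.le.trans hs.2⟩, h.le⟩) (not_le.2 hξ.2)
  have hsub : ∀ t ∈ Icc (0 : ℝ) s, Icc 0 t ⊆ Icc (0 : ℝ) 1 :=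
    fun t ht => Icc_subset_Icc_right (ht.2.trans hs.2)
  have hU0 := hU (x 0) 0 ⟨le_rfl, zero_le_one⟩ (by simpa [hx0] using hδ.le)
  have hv0' := hv 0 ⟨le_rfl, zero_le_one⟩ hU0.1
  -- Here `e ^ 2` is the drift of the momentum `U v`, `4 * e` the cost of replacing `U v` by `v` at
  -- the times `ξ` and `0`, and `1` the initial error.
  have hvel : ∀ ξ ∈ Ico (0 : ℝ) s, ‖v ξ - w‖ ≤ C * ε * (e ^ 2 + 4 * e + 1) := by
    intro ξ hξ
    have hξ1 : ξ ∈ Icc (0 : ℝ) 1 := ⟨hξ.1, hξ.2.le.trans hs.2⟩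
    have hUξ := hU (x ξ) ξ hξ1 (hlt ξ hξ)
    have hvξ := hv ξ hξ1 hUξ.1
    have hPd := norm_image_sub_le_of_norm_deriv_le_segment' (f := fun s => U (x s) • v s)
      (C := C * ε * e ^ 2) (a := 0) (b := ξ)
      (fun t ht => (hP t (hsub ξ ⟨hξ.1, hξ.2.le⟩ ht)).mono (hsub ξ ⟨hξ.1, hξ.2.le⟩))
      (fun t ht => by
        have ht1 : t ∈ Icc (0 : ℝ) 1 := hsub ξ ⟨hξ.1, hξ.2.le⟩ (Ico_subset_Icc_self ht)
        have hUt := hU (x t) t ht1 (hlt t ⟨ht.1, ht.2.trans hξ.2⟩)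
        have hvt := hv t ht1 hUt.1
        rw [norm_smul, Real.norm_eq_abs, abs_of_nonneg (by positivity)]
        calc 1 / 2 * ‖v t‖ ^ 2 * ‖g (x t)‖ ≤ 1 / 2 * (2 * e ^ 2) * (C * ε) := by
              gcongr
              · exact hvt.1
              · exact hUt.2.2
          _ = C * ε * e ^ 2 := by ring) ξ ⟨hξ.1, le_rfl⟩
    have hPd' : ‖U (x ξ) • v ξ - U (x 0) • v 0‖ ≤ C * ε * e ^ 2 := by
      refine hPd.trans ?_
      have : 0 ≤ C * ε * e ^ 2 := by positivity
      nlinarith [hξ1.2]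
    have heq : v ξ - w = (U (x ξ) • v ξ - U (x 0) • v 0) + (-(U (x ξ) - 1)) • v ξ
        + (U (x 0) - 1) • v 0 + (v 0 - w) := by module
    rw [heq]
    refine (norm_add_le _ _).trans ?_
    have h1 : ‖(-(U (x ξ) - 1)) • v ξ‖ ≤ C * ε * (2 * e) := by
      rw [norm_smul, norm_neg, Real.norm_eq_abs]
      gcongr
      exacts [hUξ.2.1, hvξ.2]
    have h2 : ‖(U (x 0) - 1) • v 0‖ ≤ C * ε * (2 * e) := by
      rw [norm_smul, Real.norm_eq_abs]
      gcongr
      exacts [hU0.2.1, hv0'.2]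
    have h3 := norm_add_le ((U (x ξ) • v ξ - U (x 0) • v 0) + (-(U (x ξ) - 1)) • v ξ)
      ((U (x 0) - 1) • v 0)
    have h4 := norm_add_le (U (x ξ) • v ξ - U (x 0) • v 0) ((-(U (x ξ) - 1)) • v ξ)
    linarith
  have hfin := norm_image_sub_le_of_norm_deriv_le_segment' (f := fun ξ => x ξ - (a + ξ • w))
    (f' := fun ξ => v ξ - w) (C := C * ε * (e ^ 2 + 4 * e + 1)) (a := 0) (b := s)
    (fun t ht => by
      have h1 := (hx t (hsub s ⟨hs.1, le_rfl⟩ ht)).mono (hsub s ⟨hs.1, le_rfl⟩)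
      have h2 : HasDerivWithinAt (fun ξ : ℝ => a + ξ • w) w (Icc 0 s) t := by
        simpa using (((hasDerivAt_id t).smul_const w).const_add a).hasDerivWithinAt
      exact h1.sub h2)
    hvel s ⟨hs.1, le_rfl⟩
  simp only [hx0, zero_smul, add_zero, sub_self, sub_zero] at hfin
  have : 0 ≤ C * ε * (e ^ 2 + 4 * e + 1) := by positivity
  nlinarith [hs.2]

/-- Along a ray starting at a zero of the field `W`, which is an approximate gradient solution `Ω` of
the eikonal equation `|∇Ω|² = 2 Ω U`, the momentum agrees with `W` up to the size of the defect. -/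
theorem abs_energy_sub_le {x v : ℝ → E} {U Ω d : E → ℝ} {g W d' : E → E} {H : E → E →L[ℝ] E}
    {e C ε L μ : ℝ} (hC : 0 ≤ C) (hε : 0 ≤ ε) (hL : 1 ≤ L) (hμ : 0 ≤ μ)
    (hsmall : (2 * C + 10 * C * L) * ε ≤ 1 / 2)
    (hx : ∀ ξ ∈ Icc (0 : ℝ) 1, HasDerivWithinAt x (v ξ) (Icc 0 1) ξ)
    (hP : ∀ ξ ∈ Icc (0 : ℝ) 1, HasDerivWithinAt (fun s => U (x s) • v s)
      ((1 / 2 * ‖v ξ‖ ^ 2) • g (x ξ)) (Icc 0 1) ξ)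
    (hnull : ∀ ξ ∈ Icc (0 : ℝ) 1, e ^ 2 = U (x ξ) * ‖v ξ‖ ^ 2)
    (hW0 : W (x 0) = 0)
    (hW : ∀ ξ ∈ Icc (0 : ℝ) 1, HasFDerivAt W (H (x ξ)) (x ξ))
    (heik : ∀ ξ ∈ Icc (0 : ℝ) 1,
      ‖W (x ξ)‖ ^ 2 = 2 * Ω (x ξ) * U (x ξ) + μ * d (x ξ))
    (hdeik : ∀ ξ ∈ Icc (0 : ℝ) 1, H (x ξ) (W (x ξ)) =
      U (x ξ) • W (x ξ) + Ω (x ξ) • g (x ξ) + μ • d' (x ξ))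
    (hU : ∀ ξ ∈ Icc (0 : ℝ) 1, 1 / 2 ≤ U (x ξ) ∧ U (x ξ) ≤ 2)
    (hv : ∀ ξ ∈ Icc (0 : ℝ) 1, ‖v ξ‖ ≤ L) (hWL : ∀ ξ ∈ Icc (0 : ℝ) 1, ‖W (x ξ)‖ ≤ L)
    (hg : ∀ ξ ∈ Icc (0 : ℝ) 1, ‖g (x ξ)‖ ≤ C * ε)
    (hH : ∀ ξ ∈ Icc (0 : ℝ) 1, ∀ b : E, ‖H (x ξ) b - U (x ξ) • b‖ ≤ C * ε * ‖b‖)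
    (hd : ∀ ξ ∈ Icc (0 : ℝ) 1, |d (x ξ)| ≤ L * ξ)
    (hd' : ∀ ξ ∈ Icc (0 : ℝ) 1, ‖d' (x ξ)‖ ≤ L * ξ) :
    |1 / 2 * e ^ 2 - Ω (x 1)| ≤ 31 * L ^ 2 * μ := by
  -- The mismatch between `ξ` times the momentum and the gradient of the approximate world function.
  set η : ℝ → E := fun s => s • (U (x s) • v s) - W (x s) with hηdef
  set η' : ℝ → E := fun s => U (x s) • v s + s • ((1 / 2 * ‖v s‖ ^ 2) • g (x s)) - H (x s) (v s)
    with hη'def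
  have hη : ∀ ξ ∈ Icc (0 : ℝ) 1, HasDerivWithinAt η (η' ξ) (Icc 0 1) ξ := by
    intro ξ hξ
    have h1 := (hasDerivWithinAt_id ξ (Icc 0 1)).smul (hP ξ hξ)
    have h2 := (hW ξ hξ).comp_hasDerivWithinAt ξ (hx ξ hξ)
    refine (h1.sub h2).congr_deriv ?_
    simp [η', add_comm]
  have hηL : ∀ ξ ∈ Icc (0 : ℝ) 1, ‖η ξ‖ ≤ 3 * L := by
    intro ξ hξ
    refine (norm_sub_le _ _).trans ?_
    rw [norm_smul, norm_smul, Real.norm_eq_abs, Real.norm_eq_abs, abs_of_nonneg hξ.1,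
      abs_of_nonneg (by linarith [(hU ξ hξ).1])]
    have h1 : ξ * (U (x ξ) * ‖v ξ‖) ≤ 1 * (2 * L) := by
      have := (hU ξ hξ).1
      gcongr
      exacts [hξ.2, (hU ξ hξ).2, hv ξ hξ]
    linarith [hWL ξ hξ]
  -- Since `η + W = ξ U v`, its squared norm is `ξ² U e²` by the first integral. Subtracting the
  -- eikonal equation for `W` controls the energy mismatch linearly by `η` and the defect.
  have hener : ∀ ξ ∈ Icc (0 : ℝ) 1, |1 / 2 * ξ ^ 2 * e ^ 2 - Ω (x ξ)| ≤
      5 * L * ‖η ξ‖ + μ * (L * ξ) := by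
    intro ξ hξ
    have hUp : 0 < U (x ξ) := by linarith [(hU ξ hξ).1]
    have h1 : ‖η ξ + W (x ξ)‖ ^ 2 = ξ ^ 2 * U (x ξ) * e ^ 2 := by
      have : η ξ + W (x ξ) = (ξ * U (x ξ)) • v ξ := by simp [η, mul_smul]
      rw [this, hnull ξ hξ, norm_smul, mul_pow, Real.norm_eq_abs, sq_abs]
      ring
    rw [norm_add_sq_real, heik ξ hξ] at h1
    have h2 : 2 * U (x ξ) * (1 / 2 * ξ ^ 2 * e ^ 2 - Ω (x ξ)) =
        ‖η ξ‖ ^ 2 + 2 * inner ℝ (η ξ) (W (x ξ)) + μ * d (x ξ) := by linarith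
    have h3 : |‖η ξ‖ ^ 2 + 2 * inner ℝ (η ξ) (W (x ξ)) + μ * d (x ξ)| ≤
        5 * L * ‖η ξ‖ + μ * (L * ξ) := by
      have hi := abs_real_inner_le_norm (η ξ) (W (x ξ))
      have hi' : ‖η ξ‖ * ‖W (x ξ)‖ ≤ ‖η ξ‖ * L := by gcongr; exact hWL ξ hξ
      have hsq : ‖η ξ‖ ^ 2 ≤ 3 * L * ‖η ξ‖ := by
        rw [sq]; gcongr; exact hηL ξ hξ
      have hdd : |μ * d (x ξ)| ≤ μ * (L * ξ) := by
        rw [abs_mul, abs_of_nonneg hμ]; gcongr; exact hd ξ hξ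
      have hsq0 := sq_nonneg ‖η ξ‖
      rw [abs_le] at hi hdd ⊢
      constructor <;> nlinarith [hi.1, hi.2, hdd.1, hdd.2]
    rw [← h2, abs_mul, abs_of_pos (by linarith)] at h3
    refine le_trans ?_ h3
    have := abs_nonneg (1 / 2 * ξ ^ 2 * e ^ 2 - Ω (x ξ))
    nlinarith [(hU ξ hξ).1]
  -- Writing `ξ U v = η + W` in `H v` and using the differentiated eikonal equation for `H W`, the
  -- main terms cancel. What remains is `(H - U) η`, the energy mismatch times `g`, and the defect;
  -- the first two are small multiples of `η`, up to the defect, and `hsmall` keeps their total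
  -- coefficient below `1/2`.
  have hmain : ∀ ξ ∈ Icc (0 : ℝ) 1, ‖ξ • η' ξ‖ ≤ 1 / 2 * ‖η ξ‖ + 3 * L * μ * ξ := by
    intro ξ hξ
    have hUp : 0 < U (x ξ) := by linarith [(hU ξ hξ).1]
    have hinv0 : 0 ≤ (U (x ξ))⁻¹ := by positivity
    have hinv : (U (x ξ))⁻¹ ≤ 2 := by
      rw [inv_le_comm₀ hUp (by norm_num)]; linarith [(hU ξ hξ).1]
    have heq : ξ • η' ξ = -((U (x ξ))⁻¹ • (H (x ξ) (η ξ) - U (x ξ) • η ξ)) +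
        ((U (x ξ))⁻¹ * (1 / 2 * ξ ^ 2 * e ^ 2 - Ω (x ξ))) • g (x ξ) -
        ((U (x ξ))⁻¹ * μ) • d' (x ξ) := by
      have h1 : H (x ξ) (η ξ) = (ξ * U (x ξ)) • H (x ξ) (v ξ) -
          (U (x ξ) • W (x ξ) + Ω (x ξ) • g (x ξ) + μ • d' (x ξ)) := by
        rw [← hdeik ξ hξ]
        simp [η, mul_smul]
      rw [h1, hnull ξ hξ]
      simp only [η, η']
      match_scalars <;> field_simp <;> ring
    have t1 : ‖(U (x ξ))⁻¹ • (H (x ξ) (η ξ) - U (x ξ) • η ξ)‖ ≤ 2 * (C * ε * ‖η ξ‖) := by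
      rw [norm_smul, Real.norm_eq_abs, abs_of_nonneg hinv0]
      gcongr
      exact hH ξ hξ _
    have t2 : ‖((U (x ξ))⁻¹ * (1 / 2 * ξ ^ 2 * e ^ 2 - Ω (x ξ))) • g (x ξ)‖ ≤
        2 * (5 * L * ‖η ξ‖ + μ * (L * ξ)) * (C * ε) := by
      rw [norm_smul, Real.norm_eq_abs, abs_mul, abs_of_nonneg hinv0]
      have := hener ξ hξ
      have h0 := hξ.1
      have : 0 ≤ 5 * L * ‖η ξ‖ + μ * (L * ξ) := (abs_nonneg _).trans this
      gcongr
      exact hg ξ hξ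
    have t3 : ‖((U (x ξ))⁻¹ * μ) • d' (x ξ)‖ ≤ 2 * μ * (L * ξ) := by
      rw [norm_smul, Real.norm_eq_abs, abs_of_nonneg (by positivity)]
      gcongr
      exact hd' ξ hξ
    rw [heq]
    have n1 := norm_sub_le (-((U (x ξ))⁻¹ • (H (x ξ) (η ξ) - U (x ξ) • η ξ)) +
        ((U (x ξ))⁻¹ * (1 / 2 * ξ ^ 2 * e ^ 2 - Ω (x ξ))) • g (x ξ)) (((U (x ξ))⁻¹ * μ) • d' (x ξ))
    have n2 := norm_add_le (-((U (x ξ))⁻¹ • (H (x ξ) (η ξ) - U (x ξ) • η ξ)))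
      (((U (x ξ))⁻¹ * (1 / 2 * ξ ^ 2 * e ^ 2 - Ω (x ξ))) • g (x ξ))
    rw [norm_neg] at n2
    have s1 : (2 * C + 10 * C * L) * ε * ‖η ξ‖ ≤ 1 / 2 * ‖η ξ‖ := by gcongr
    have s2 : 2 * C * ε ≤ 1 := by
      have : 0 ≤ 10 * C * L * ε := by positivity
      linarith
    have s3 : 2 * C * ε * (μ * (L * ξ)) ≤ 1 * (μ * (L * ξ)) := by
      have := hξ.1
      gcongr
    linarith
  have hK : ∀ ξ ∈ Icc (0 : ℝ) 1, ‖η' ξ‖ ≤ 2 * L + 1 / 2 * L ^ 2 * (C * ε) + (C * ε * L + 2 * L) := by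
    intro ξ hξ
    have hUp : 0 < U (x ξ) := by linarith [(hU ξ hξ).1]
    have h1 : ‖U (x ξ) • v ξ‖ ≤ 2 * L := by
      rw [norm_smul, Real.norm_eq_abs, abs_of_pos hUp]
      gcongr
      exacts [(hU ξ hξ).2, hv ξ hξ]
    have h2 : ‖ξ • ((1 / 2 * ‖v ξ‖ ^ 2) • g (x ξ))‖ ≤ 1 * (1 / 2 * L ^ 2 * (C * ε)) := by
      rw [norm_smul, norm_smul, Real.norm_eq_abs, Real.norm_eq_abs, abs_of_nonneg hξ.1,
        abs_of_nonneg (by positivity)]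
      gcongr
      exacts [hξ.2, hv ξ hξ, hg ξ hξ]
    have h3 : ‖H (x ξ) (v ξ)‖ ≤ C * ε * L + 2 * L := by
      have a1 := hH ξ hξ (v ξ)
      have a2 : ‖H (x ξ) (v ξ)‖ ≤ ‖H (x ξ) (v ξ) - U (x ξ) • v ξ‖ + ‖U (x ξ) • v ξ‖ := by
        simpa using norm_add_le (H (x ξ) (v ξ) - U (x ξ) • v ξ) (U (x ξ) • v ξ)
      have a3 : C * ε * ‖v ξ‖ ≤ C * ε * L := by gcongr; exact hv ξ hξ
      linarith
    have n1 := norm_sub_le (U (x ξ) • v ξ + ξ • ((1 / 2 * ‖v ξ‖ ^ 2) • g (x ξ))) (H (x ξ) (v ξ))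
    have n2 := norm_add_le (U (x ξ) • v ξ) (ξ • ((1 / 2 * ‖v ξ‖ ^ 2) • g (x ξ)))
    simp only [η']
    linarith
  have hone : (1 : ℝ) ∈ Icc (0 : ℝ) 1 := ⟨zero_le_one, le_rfl⟩
  have hη1 := norm_le_mul_of_norm_smul_deriv_le hη (by simp [η, hW0]) hK hmain 1 hone
  have hfin := hener 1 hone
  simp only [one_pow, mul_one] at hfin hη1
  refine hfin.trans ?_
  -- This contributes `30 L² μ`; the defect term adds at most `L² μ`, whence the constant `31`.
  have h5 : 5 * L * ‖η 1‖ ≤ 5 * L * (2 * (3 * L * μ)) := by gcongr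
  have h6 : μ * L ≤ μ * L ^ 2 := by gcongr; nlinarith
  nlinarith

end RayEstimates

/-! ### The refractive potential as a smooth function of `m / r` and its Taylor expansion. -/

section Potential

theorem contDiffOn_tsum_pow {c : ℕ → ℝ} {t₁ : ℝ} (ht₁ : 0 < t₁)
    (hc : Summable fun n : ℕ => c n * t₁ ^ n) :
    ContDiffOn ℝ ∞ (fun t : ℝ => ∑' n : ℕ, c n * t ^ n) (Ioo (-t₁) t₁) := by
  set p := FormalMultilinearSeries.ofScalars ℝ c with hp
  have hr : ENNReal.ofReal t₁ ≤ p.radius := by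
    refine p.le_radius_of_tendsto (l := 0) (r := t₁.toNNReal) ?_
    have := hc.tendsto_atTop_zero.norm
    simp only [norm_mul, norm_pow, Real.norm_eq_abs, abs_of_pos ht₁, norm_zero] at this
    refine this.congr fun n => ?_
    rw [hp, FormalMultilinearSeries.ofScalars_norm, Real.coe_toNNReal _ ht₁.le, Real.norm_eq_abs]
  have hpos : 0 < p.radius := lt_of_lt_of_le (by simpa using ht₁) hr
  have hball := (p.hasFPowerSeriesOnBall hpos).mono (by simpa using ht₁) hr
  have han : ContDiffOn ℝ ∞ p.sum (Ioo (-t₁) t₁) := by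
    intro t ht
    refine (hball.analyticOnNhd t ?_).contDiffAt.contDiffWithinAt
    simpa [Metric.mem_eball, edist_dist, Real.dist_eq, ENNReal.ofReal_lt_ofReal_iff ht₁, abs_lt] using ht
  refine han.congr fun t _ => ?_
  rw [FormalMultilinearSeries.sum]
  refine tsum_congr fun n => ?_
  simp [hp, mul_comm]

theorem exists_tsum_pow_eq_sum_add {c : ℕ → ℝ} {t₁ : ℝ} (ht₁ : 0 < t₁)
    (hc : Summable fun n : ℕ => c n * t₁ ^ n) (N : ℕ) :
    ∃ q : ℝ → ℝ, ContDiffOn ℝ ∞ q (Ioo (-t₁) t₁) ∧ ∀ t ∈ Ioo (-t₁) t₁,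
      ∑' n : ℕ, c n * t ^ n = ∑ n ∈ Finset.range N, c n * t ^ n + t ^ N * q t := by
  refine ⟨fun t => ∑' n : ℕ, c (n + N) * t ^ n, contDiffOn_tsum_pow ht₁ ?_, fun t ht => ?_⟩
  · have := ((summable_nat_add_iff N).2 hc).mul_right (t₁ ^ N)⁻¹
    refine this.congr fun n => ?_
    rw [pow_add]; field_simp
  · have hst : Summable fun n : ℕ => c n * t ^ n := by
      have habs : |t| < t₁ := abs_lt.2 ht
      obtain ⟨B, hB⟩ := hc.tendsto_atTop_zero.norm.bddAbove_range
      have hq : Summable fun n : ℕ => B * (|t| / t₁) ^ n :=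
        (summable_geometric_of_lt_one (by positivity) ((div_lt_one ht₁).2 habs)).mul_left B
      refine Summable.of_norm_bounded hq fun n => ?_
      have h := hB ⟨n, rfl⟩
      simp only [norm_mul, norm_pow, Real.norm_eq_abs, abs_of_pos ht₁] at h ⊢
      have : |c n| * |t| ^ n = |c n| * t₁ ^ n * (|t| / t₁) ^ n := by
        rw [div_pow]; field_simp
      rw [this]
      gcongr
    rw [← hst.sum_add_tsum_nat_add N, ← tsum_mul_left]
    congr 1
    refine tsum_congr fun n => ?_
    ring

namespace PNParameters

variable (P : PNParameters)

/-- The coefficients of `𝒰` in powers of `m / r`. -/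
def uCoeff (n : ℕ) : ℝ :=
  PowerSeries.coeff n (PowerSeries.mk P.bCoeff * (PowerSeries.mk P.aCoeff)⁻¹)

theorem kappa_eq (n : ℕ) : P.kappa n = P.uCoeff n / 2 := rfl

theorem constantCoeff_mk_aCoeff : PowerSeries.constantCoeff (PowerSeries.mk P.aCoeff) = 1 := by
  rw [← PowerSeries.coeff_zero_eq_constantCoeff_apply, PowerSeries.coeff_mk]; rfl

theorem mk_uCoeff_mul :
    PowerSeries.mk P.aCoeff * PowerSeries.mk P.uCoeff = PowerSeries.mk P.bCoeff := by
  have : PowerSeries.mk P.uCoeff = PowerSeries.mk P.bCoeff * (PowerSeries.mk P.aCoeff)⁻¹ := by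
    ext n; simp [uCoeff]
  rw [this, mul_left_comm, PowerSeries.mul_inv_cancel _ (by simp [P.constantCoeff_mk_aCoeff]),
    mul_one]

theorem uCoeff_zero : P.uCoeff 0 = 1 := by
  have h := congrArg (PowerSeries.coeff 0) P.mk_uCoeff_mul
  simpa [PowerSeries.coeff_mul, aCoeff, bCoeff] using h

theorem uCoeff_one : P.uCoeff 1 = 2 * (1 + P.γ) := by
  have h := congrArg (PowerSeries.coeff 1) P.mk_uCoeff_mul
  simp [PowerSeries.coeff_mul, Finset.Nat.antidiagonal_succ, aCoeff, bCoeff, P.uCoeff_zero] at h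
  linarith

/-- The potential `𝒰` as a function of `m / r`. -/
def ratio (t : ℝ) : ℝ := (∑' n : ℕ, P.bCoeff n * t ^ n) / ∑' n : ℕ, P.aCoeff n * t ^ n

theorem potU_eq (m r : ℝ) : P.potU m r = P.ratio (m / r) := rfl

/-- Links the formal quotient defining the coefficients of `𝒰` with the quotient of the actual sums,
with a smooth remainder. The interval is a full neighbourhood of `0`, so that derivatives with
respect to `m` at `m = 0` are available. -/
theorem exists_ratio_expansion {ρ : ℝ} (hreg : P.IsRegular ρ) (N : ℕ) :
    ∃ t₀ : ℝ, 0 < t₀ ∧ ContDiffOn ℝ ∞ P.ratio (Ioo (-t₀) t₀) ∧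
      ∃ h : ℝ → ℝ, ContDiffOn ℝ ∞ h (Ioo (-t₀) t₀) ∧ ∀ t ∈ Ioo (-t₀) t₀,
        P.ratio t = ∑ k ∈ Finset.range (N + 1), P.uCoeff k * t ^ k + t ^ (N + 1) * h t := by
  obtain ⟨hρ, hreg⟩ := hreg
  -- Only `m / r` matters, so one admissible pair, `m = 1` and `r = 2ρ`, gives convergence at `1 /
  -- (2ρ)`.
  obtain ⟨ha, hb, -, -⟩ := hreg 1 (2 * ρ) one_pos (by linarith)
  have ht₁ : 0 < 1 / (2 * ρ) := by positivity
  obtain ⟨qa, hqa, hqa'⟩ := exists_tsum_pow_eq_sum_add ht₁ ha (N + 1)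
  obtain ⟨qb, hqb, hqb'⟩ := exists_tsum_pow_eq_sum_add ht₁ hb (N + 1)
  have hA := contDiffOn_tsum_pow ht₁ ha
  have hB := contDiffOn_tsum_pow ht₁ hb
  set A : ℝ → ℝ := fun t => ∑' n : ℕ, P.aCoeff n * t ^ n with hAdef
  set B : ℝ → ℝ := fun t => ∑' n : ℕ, P.bCoeff n * t ^ n with hBdef
  have hA0 : A 0 = 1 := by
    rw [hAdef]
    simp only
    rw [tsum_eq_single 0 (by intro n hn; simp [hn])]
    simp [aCoeff]
  have hnhds : Ioo (-(1 / (2 * ρ))) (1 / (2 * ρ)) ∈ 𝓝 (0 : ℝ) := Ioo_mem_nhds (by linarith) ht₁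
  have hev : ∀ᶠ t in 𝓝 (0 : ℝ), t ∈ Ioo (-(1 / (2 * ρ))) (1 / (2 * ρ)) ∧ 0 < A t := by
    refine Filter.Eventually.and hnhds ?_
    have : ContinuousAt A 0 := hA.continuousOn.continuousAt hnhds
    exact this.eventually (lt_mem_nhds (by rw [hA0]; exact one_pos))
  obtain ⟨t₀, ht₀, hball⟩ := Metric.eventually_nhds_iff.1 hev
  have hI : ∀ t ∈ Ioo (-t₀) t₀, t ∈ Ioo (-(1 / (2 * ρ))) (1 / (2 * ρ)) ∧ 0 < A t :=
    fun t ht => hball (by simpa [Real.dist_eq, abs_lt] using ht)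
  have hsub : Ioo (-t₀) t₀ ⊆ Ioo (-(1 / (2 * ρ))) (1 / (2 * ρ)) := fun t ht => (hI t ht).1
  set TA := PowerSeries.trunc (N + 1) (PowerSeries.mk P.aCoeff)
  set TB := PowerSeries.trunc (N + 1) (PowerSeries.mk P.bCoeff)
  set TU := PowerSeries.trunc (N + 1) (PowerSeries.mk P.uCoeff)
  -- The formal identity `a · u = b` survives truncation up to degree `N`; the quotient `Q` enters
  -- the remainder.
  have hdvd : Polynomial.X ^ (N + 1) ∣ TB - TA * TU := by
    rw [Polynomial.X_pow_dvd_iff]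
    intro d hd
    rw [Polynomial.coeff_sub, sub_eq_zero, ← Polynomial.coeff_coe (TA * TU), Polynomial.coe_mul,
      ← PowerSeries.coeff_mul_eq_coeff_trunc_mul_trunc _ _ hd,
      P.mk_uCoeff_mul, PowerSeries.coeff_trunc, if_pos hd]
  obtain ⟨Q, hQ⟩ := hdvd
  have heval : ∀ (f : ℕ → ℝ) (t : ℝ), (PowerSeries.trunc (N + 1) (PowerSeries.mk f)).eval t =
      ∑ k ∈ Finset.range (N + 1), f k * t ^ k := by
    intro f t
    rw [← Polynomial.eval₂_id, PowerSeries.eval₂_trunc_eq_sum_range]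
    simp
  refine ⟨t₀, ht₀, (hB.mono hsub).div (hA.mono hsub) fun t ht => (hI t ht).2.ne',
    fun t => (Q.eval t + qb t - qa t * TU.eval t) / A t, ?_, fun t ht => ?_⟩
  · refine ContDiffOn.div ?_ (hA.mono hsub) fun t ht => (hI t ht).2.ne'
    have hpoly : ∀ p : Polynomial ℝ, ContDiffOn ℝ ∞ (fun t => p.eval t) (Ioo (-t₀) t₀) :=
      fun p => by
        simpa using (p.contDiff_aeval (𝕜 := ℝ) ∞).contDiffOn (s := Ioo (-t₀) t₀)
    exact ((hpoly Q).add (hqb.mono hsub)).sub ((hqa.mono hsub).mul (hpoly TU))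
  · have hAt := (hI t ht).2
    have hQt := congrArg (Polynomial.eval t) hQ
    simp only [Polynomial.eval_sub, Polynomial.eval_mul, Polynomial.eval_pow, Polynomial.eval_X] at hQt
    have hat : A t = TA.eval t + t ^ (N + 1) * qa t := by rw [heval]; exact hqa' t (hsub ht)
    have hbt : B t = TB.eval t + t ^ (N + 1) * qb t := by rw [heval]; exact hqb' t (hsub ht)
    rw [← heval]
    change B t / A t = TU.eval t + t ^ (N + 1) * ((Q.eval t + qb t - qa t * TU.eval t) / A t)
    rw [div_eq_iff hAt.ne', add_mul, mul_assoc, div_mul_cancel₀ _ hAt.ne']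
    rw [hbt, hat]
    linear_combination hQt

end PNParameters

end Potential

/-! ### The formal solution of the eikonal equation and its world function. -/

section Eikonal

/-- The scalar product of the gradients of `‖x - a‖ f` and `‖x - a‖ g`, in a form that is regular at
the point `a`. -/
def eikonalProduct (a : E3) (f g : E3 → ℝ) (x : E3) : ℝ :=
  f x * g x + f x * fderiv ℝ g x (x - a) + g x * fderiv ℝ f x (x - a) +
    ‖x - a‖ ^ 2 * inner ℝ (gradient f x) (gradient g x)

theorem inner_gradient_left (f : E3 → ℝ) (x w : E3) :
    inner ℝ (gradient f x) w = fderiv ℝ f x w := by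
  simp [gradient]

theorem norm_gradient (f : E3 → ℝ) (x : E3) : ‖gradient f x‖ = ‖fderiv ℝ f x‖ := by
  simp [gradient]

theorem gradient_eq_of_forall_inner {f : E3 → ℝ} {f' : E3 →L[ℝ] ℝ} {x g : E3}
    (hf : HasFDerivAt f f' x) (h : ∀ w, f' w = inner ℝ g w) : gradient f x = g := by
  refine ext_inner_right ℝ fun w => ?_
  rw [inner_gradient_left, hf.fderiv, h]

theorem hasFDerivAt_norm_sub {a x : E3} (hx : x ≠ a) :
    HasFDerivAt (fun y : E3 => ‖y - a‖) (‖x - a‖⁻¹ • innerSL ℝ (x - a)) x := by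
  have hne : x - a ≠ 0 := sub_ne_zero.2 hx
  have h1 : HasFDerivAt (fun y : E3 => ‖y - a‖ ^ 2) (2 • innerSL ℝ (x - a)) x := by
    have := ((hasFDerivAt_id x).sub_const a).norm_sq
    refine this.congr_fderiv ?_
    ext w; simp
  have h2 : DifferentiableAt ℝ (fun y : E3 => ‖y - a‖) x :=
    (differentiableAt_id.sub_const a).norm ℝ hne
  have h3 := h2.hasFDerivAt.pow 2
  have h4 := h3.unique h1
  have h5 : fderiv ℝ (fun y : E3 => ‖y - a‖) x = ‖x - a‖⁻¹ • innerSL ℝ (x - a) := by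
    ext w
    have h6 := congrArg (fun l : E3 →L[ℝ] ℝ => l w) h4
    have hn : ‖x - a‖ ≠ 0 := norm_ne_zero_iff.2 hne
    simp at h6
    simp
    field_simp
    linarith
  rw [← h5]
  exact h2.hasFDerivAt

theorem inner_gradient_norm_sub_mul {a x : E3} {f g : E3 → ℝ} (hx : x ≠ a)
    (hf : DifferentiableAt ℝ f x) (hg : DifferentiableAt ℝ g x) :
    inner ℝ (gradient (fun y => ‖y - a‖ * f y) x) (gradient (fun y => ‖y - a‖ * g y) x) =
      eikonalProduct a f g x := by
  have hn : ‖x - a‖ ≠ 0 := norm_ne_zero_iff.2 (sub_ne_zero.2 hx)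
  have key : ∀ k : E3 → ℝ, DifferentiableAt ℝ k x → gradient (fun y => ‖y - a‖ * k y) x =
      (‖x - a‖⁻¹ * k x) • (x - a) + ‖x - a‖ • gradient k x := by
    intro k hk
    refine gradient_eq_of_forall_inner ((hasFDerivAt_norm_sub hx).mul hk.hasFDerivAt) fun w => ?_
    simp only [inner_add_left, inner_smul_left, inner_gradient_left, innerSL_apply_apply,
      add_apply, smul_apply, smul_eq_mul, RCLike.conj_to_real]
    ring
  rw [key f hf, key g hg]
  simp only [inner_add_left, inner_add_right, inner_smul_left, inner_smul_right,
    real_inner_self_eq_norm_sq, RCLike.conj_to_real, inner_gradient_left]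
  rw [real_inner_comm, inner_gradient_left]
  unfold eikonalProduct
  rw [inner_gradient_left]
  field_simp
  ring

theorem contDiffOn_gradient {f : E3 → ℝ} {D : Set E3} (hD : IsOpen D) (hf : ContDiffOn ℝ ∞ f D) :
    ContDiffOn ℝ ∞ (gradient f) D :=
  (InnerProductSpace.toDual ℝ E3).symm.contDiff.comp_contDiffOn (hf.fderiv_of_isOpen hD (by simp))

theorem contDiffOn_eikonalProduct {a : E3} {f g : E3 → ℝ} {D : Set E3} (hD : IsOpen D)
    (hf : ContDiffOn ℝ ∞ f D) (hg : ContDiffOn ℝ ∞ g D) :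
    ContDiffOn ℝ ∞ (eikonalProduct a f g) D := by
  have hsub : ContDiffOn ℝ ∞ (fun x : E3 => x - a) D := by fun_prop
  have hf' : ContDiffOn ℝ ∞ (fun x => fderiv ℝ f x (x - a)) D :=
    (hf.fderiv_of_isOpen hD (by simp)).clm_apply hsub
  have hg' : ContDiffOn ℝ ∞ (fun x => fderiv ℝ g x (x - a)) D :=
    (hg.fderiv_of_isOpen hD (by simp)).clm_apply hsub
  exact (((hf.mul hg).add (hf.mul hg')).add (hg.mul hf')).add
    ((hsub.norm_sq ℝ).mul ((contDiffOn_gradient hD hf).inner ℝ (contDiffOn_gradient hD hg)))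

/-- The coefficients `Fₙ` of the formal solution `‖x - a‖ ∑ mⁿ Fₙ` of the eikonal equation with
squared index `∑ uₙ mⁿ / ‖x‖ⁿ`. -/
def eikonalTerm (u : ℕ → ℝ) (a : E3) : ℕ → E3 → ℝ
  | 0 => fun _ => 1
  | n + 1 => fun x => ∫ ξ in (0 : ℝ)..1, (u (n + 1) / 2 * (1 / ‖a + ξ • (x - a)‖ ^ (n + 1)) -
      1 / 2 * ∑ p : Fin n, eikonalProduct a (eikonalTerm u a (p + 1)) (eikonalTerm u a (n - p))
        (a + ξ • (x - a)))
  termination_by n => n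

variable {u : ℕ → ℝ} {a : E3} {D : Set E3}

theorem eikonalTerm_zero : eikonalTerm u a 0 = fun _ => 1 := by rw [eikonalTerm]

/-- The source of the recurrence for `eikonalTerm`. -/
def eikonalSource (u : ℕ → ℝ) (a : E3) (n : ℕ) (y : E3) : ℝ :=
  u (n + 1) / 2 * (1 / ‖y‖ ^ (n + 1)) - 1 / 2 * ∑ p ∈ Finset.range n,
    eikonalProduct a (eikonalTerm u a (p + 1)) (eikonalTerm u a (n - p)) y

theorem eikonalTerm_succ (n : ℕ) : eikonalTerm u a (n + 1) =
    fun x => ∫ ξ in (0 : ℝ)..1, eikonalSource u a n (a + ξ • (x - a)) := by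
  rw [eikonalTerm]
  simp only [eikonalSource, Finset.sum_range]

theorem contDiffOn_eikonalSource_of (hDo : IsOpen D) (hD0 : (0 : E3) ∉ D) {n : ℕ}
    (h : ∀ k ≤ n, ContDiffOn ℝ ∞ (eikonalTerm u a k) D) :
    ContDiffOn ℝ ∞ (eikonalSource u a n) D := by
  have hne : ∀ x ∈ D, x ≠ 0 := fun x hx h0 => hD0 (h0 ▸ hx)
  have hnorm : ContDiffOn ℝ ∞ (fun x : E3 => ‖x‖) D := contDiffOn_id.norm ℝ hne
  refine (contDiffOn_const.mul (contDiffOn_const.div (hnorm.pow (n + 1)) fun x hx =>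
    pow_ne_zero _ (norm_ne_zero_iff.2 (hne x hx)))).sub (contDiffOn_const.mul
    (ContDiffOn.sum fun p hp => ?_))
  have := Finset.mem_range.1 hp
  exact contDiffOn_eikonalProduct hDo (h _ (by omega)) (h _ (by omega))

theorem contDiffOn_eikonalTerm (hDo : IsOpen D) (hD : StarConvex ℝ a D) (hD0 : (0 : E3) ∉ D)
    (n : ℕ) : ContDiffOn ℝ ∞ (eikonalTerm u a n) D := by
  induction n using Nat.strong_induction_on with
  | _ n ih =>
    rcases n with _ | n
    · rw [eikonalTerm_zero]; exact contDiffOn_const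
    · rw [eikonalTerm_succ]
      exact contDiffOn_segment_integral hDo hD
        (contDiffOn_eikonalSource_of hDo hD0 fun k hk => ih k (by omega))

theorem contDiffOn_eikonalSource (hDo : IsOpen D) (hD : StarConvex ℝ a D) (hD0 : (0 : E3) ∉ D)
    (n : ℕ) : ContDiffOn ℝ ∞ (eikonalSource u a n) D :=
  contDiffOn_eikonalSource_of hDo hD0 fun k _ => contDiffOn_eikonalTerm hDo hD hD0 k

theorem eikonalTerm_succ_add_fderiv (hDo : IsOpen D) (hD : StarConvex ℝ a D) (hD0 : (0 : E3) ∉ D)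
    (n : ℕ) {x : E3} (hx : x ∈ D) :
    eikonalTerm u a (n + 1) x + fderiv ℝ (eikonalTerm u a (n + 1)) x (x - a) =
      eikonalSource u a n x := by
  rw [eikonalTerm_succ]
  exact segment_integral_add_fderiv hDo hD (contDiffOn_eikonalSource hDo hD hD0 n) hx

theorem eikonalProduct_comm (f g : E3 → ℝ) (x : E3) :
    eikonalProduct a f g x = eikonalProduct a g f x := by
  unfold eikonalProduct
  rw [real_inner_comm]
  ring

theorem eikonalProduct_one (g : E3 → ℝ) (x : E3) :
    eikonalProduct a (fun _ => 1) g x = g x + fderiv ℝ g x (x - a) := by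
  have h : gradient (fun _ : E3 => (1 : ℝ)) x = 0 := by
    simp [gradient]
  simp [eikonalProduct, h]

/-- The eikonal equation, order by order. -/
theorem sum_eikonalProduct (hDo : IsOpen D) (hD : StarConvex ℝ a D) (hD0 : (0 : E3) ∉ D)
    (hu : u 0 = 1) (k : ℕ) {x : E3} (hx : x ∈ D) :
    ∑ p ∈ Finset.range (k + 1),
      eikonalProduct a (eikonalTerm u a p) (eikonalTerm u a (k - p)) x = u k / ‖x‖ ^ k := by
  rcases k with _ | n
  · simp [eikonalTerm_zero, eikonalProduct_one, hu]
  -- The extreme terms `p = 0` and `p = n + 1` each equal `Fₙ₊₁ + (x - a)·∇Fₙ₊₁`, that is, the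
  -- source. Twice the source cancels the intermediate products and leaves the coefficient of the
  -- potential.
  · rw [Finset.sum_range_succ, Finset.sum_range_succ']
    simp only [Nat.sub_self, Nat.sub_zero, eikonalTerm_zero]
    rw [eikonalProduct_comm (eikonalTerm u a (n + 1)), eikonalProduct_one,
      eikonalTerm_succ_add_fderiv hDo hD hD0 n hx, eikonalSource]
    simp only [Nat.add_sub_add_right]
    ring

/-- The truncation of `∑ mⁿ Fₙ` at order `N`. -/
def eikonalSum (u : ℕ → ℝ) (a : E3) (N : ℕ) (m : ℝ) (x : E3) : ℝ :=
  ∑ n ∈ Finset.range (N + 1), m ^ n * eikonalTerm u a n x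

/-- Half the square of the truncated formal solution of the eikonal equation. -/
def worldFunction (u : ℕ → ℝ) (a : E3) (N : ℕ) (m : ℝ) (x : E3) : ℝ :=
  1 / 2 * ‖x - a‖ ^ 2 * eikonalSum u a N m x ^ 2

theorem contDiffOn_uncurry_eikonalSum (hDo : IsOpen D) (hD : StarConvex ℝ a D)
    (hD0 : (0 : E3) ∉ D) (N : ℕ) :
    ContDiffOn ℝ ∞ (Function.uncurry (eikonalSum u a N)) (univ ×ˢ D) := by
  change ContDiffOn ℝ ∞ (fun q : ℝ × E3 => ∑ n ∈ Finset.range (N + 1),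
    q.1 ^ n * eikonalTerm u a n q.2) (univ ×ˢ D)
  refine ContDiffOn.sum fun n _ => ?_
  have h1 : ContDiffOn ℝ ∞ (fun q : ℝ × E3 => q.1 ^ n) (univ ×ˢ D) := by fun_prop
  exact h1.mul ((contDiffOn_eikonalTerm hDo hD hD0 n).comp contDiffOn_snd fun q hq => hq.2)

theorem contDiffOn_uncurry_worldFunction (hDo : IsOpen D) (hD : StarConvex ℝ a D)
    (hD0 : (0 : E3) ∉ D) (N : ℕ) :
    ContDiffOn ℝ ∞ (Function.uncurry (worldFunction u a N)) (univ ×ˢ D) := by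
  have h1 : ContDiffOn ℝ ∞ (fun q : ℝ × E3 => 1 / 2 * ‖q.2 - a‖ ^ 2) (univ ×ˢ D) := by
    have h0 : ContDiffOn ℝ ∞ (fun q : ℝ × E3 => q.2 - a) (univ ×ˢ D) := by fun_prop
    exact contDiffOn_const.mul (h0.norm_sq ℝ)
  exact h1.mul ((contDiffOn_uncurry_eikonalSum hDo hD hD0 N).pow 2)

theorem eikonalSum_zero_right (N : ℕ) (x : E3) : eikonalSum u a N 0 x = 1 := by
  unfold eikonalSum
  rw [Finset.sum_eq_single_of_mem 0 (by simp)]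
  · simp [eikonalTerm_zero]
  · intro n _ hn; simp [hn]

theorem gradient_worldFunction {N : ℕ} {m : ℝ} {x : E3}
    (h : DifferentiableAt ℝ (eikonalSum u a N m) x) :
    gradient (worldFunction u a N m) x = (eikonalSum u a N m x ^ 2) • (x - a) +
      (‖x - a‖ ^ 2 * eikonalSum u a N m x) • gradient (eikonalSum u a N m) x := by
  have h1 : HasFDerivAt (fun y : E3 => 1 / 2 * ‖y - a‖ ^ 2) (innerSL ℝ (x - a)) x := by
    refine (((hasFDerivAt_id x).sub_const a).norm_sq.const_mul (1 / 2 : ℝ)).congr_fderiv ?_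
    ext w; simp
  refine gradient_eq_of_forall_inner (h1.mul (h.hasFDerivAt.pow 2)) fun w => ?_
  simp only [inner_add_left, inner_smul_left, inner_gradient_left, innerSL_apply_apply,
    add_apply, smul_apply, smul_eq_mul, RCLike.conj_to_real]
  push_cast
  ring

/-- With `φ = ‖x - a‖ S`, this is `|∇(½φ²)|² = φ² |∇φ|²`, written so as to remain valid at `a`,
where `φ` need not be differentiable. -/
theorem norm_gradient_worldFunction_sq {N : ℕ} {m : ℝ} {x : E3}
    (h : DifferentiableAt ℝ (eikonalSum u a N m) x) :
    ‖gradient (worldFunction u a N m) x‖ ^ 2 =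
      2 * worldFunction u a N m x * eikonalProduct a (eikonalSum u a N m) (eikonalSum u a N m) x := by
  rw [gradient_worldFunction h, ← real_inner_self_eq_norm_sq]
  simp only [inner_add_left, inner_add_right, inner_smul_left, inner_smul_right,
    real_inner_self_eq_norm_sq, RCLike.conj_to_real, inner_gradient_left]
  rw [real_inner_comm, inner_gradient_left]
  simp only [worldFunction, eikonalProduct, real_inner_self_eq_norm_sq]
  ring

theorem eikonalProduct_eikonalSum (hDo : IsOpen D) (hD : StarConvex ℝ a D)
    (hD0 : (0 : E3) ∉ D) (N : ℕ) (m : ℝ) {x : E3} (hx : x ∈ D) :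
    eikonalProduct a (eikonalSum u a N m) (eikonalSum u a N m) x =
      ∑ p ∈ Finset.range (N + 1), ∑ q ∈ Finset.range (N + 1), m ^ (p + q) *
        eikonalProduct a (eikonalTerm u a p) (eikonalTerm u a q) x := by
  have hdiff : ∀ n, DifferentiableAt ℝ (eikonalTerm u a n) x := fun n =>
    ((contDiffOn_eikonalTerm hDo hD hD0 n).differentiableOn (by simp)).differentiableAt
      (hDo.mem_nhds hx)
  have hf : HasFDerivAt (eikonalSum u a N m)
      (∑ n ∈ Finset.range (N + 1), m ^ n • fderiv ℝ (eikonalTerm u a n) x) x :=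
    HasFDerivAt.fun_sum fun n _ => (hdiff n).hasFDerivAt.const_mul (m ^ n)
  have hg : gradient (eikonalSum u a N m) x =
      ∑ n ∈ Finset.range (N + 1), m ^ n • gradient (eikonalTerm u a n) x := by
    refine gradient_eq_of_forall_inner hf fun w => ?_
    simp [sum_inner, inner_smul_left]
  have hi : inner ℝ (gradient (eikonalSum u a N m) x) (gradient (eikonalSum u a N m) x) =
      ∑ p ∈ Finset.range (N + 1), ∑ q ∈ Finset.range (N + 1), m ^ (p + q) *
        inner ℝ (gradient (eikonalTerm u a p) x) (gradient (eikonalTerm u a q) x) := by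
    simp only [hg, sum_inner, inner_sum, inner_smul_left, inner_smul_right, RCLike.conj_to_real]
    refine Finset.sum_congr rfl fun p _ => ?_
    rw [Finset.mul_sum]
    refine Finset.sum_congr rfl fun q _ => ?_
    rw [real_inner_comm]
    ring
  have hl : fderiv ℝ (eikonalSum u a N m) x (x - a) =
      ∑ n ∈ Finset.range (N + 1), m ^ n * fderiv ℝ (eikonalTerm u a n) x (x - a) := by
    rw [hf.fderiv]; simp
  have h3 : eikonalSum u a N m x * fderiv ℝ (eikonalSum u a N m) x (x - a) =
      ∑ p ∈ Finset.range (N + 1), ∑ q ∈ Finset.range (N + 1), m ^ (p + q) *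
        (eikonalTerm u a q x * fderiv ℝ (eikonalTerm u a p) x (x - a)) := by
    rw [mul_comm, hl, eikonalSum, Finset.sum_mul_sum]
    exact Finset.sum_congr rfl fun p _ => Finset.sum_congr rfl fun q _ => by ring
  have h2 : eikonalSum u a N m x * fderiv ℝ (eikonalSum u a N m) x (x - a) =
      ∑ p ∈ Finset.range (N + 1), ∑ q ∈ Finset.range (N + 1), m ^ (p + q) *
        (eikonalTerm u a p x * fderiv ℝ (eikonalTerm u a q) x (x - a)) := by
    rw [hl, eikonalSum, Finset.sum_mul_sum]
    exact Finset.sum_congr rfl fun p _ => Finset.sum_congr rfl fun q _ => by ring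
  have h1 : eikonalSum u a N m x * eikonalSum u a N m x =
      ∑ p ∈ Finset.range (N + 1), ∑ q ∈ Finset.range (N + 1), m ^ (p + q) *
        (eikonalTerm u a p x * eikonalTerm u a q x) := by
    rw [eikonalSum, Finset.sum_mul_sum]
    exact Finset.sum_congr rfl fun p _ => Finset.sum_congr rfl fun q _ => by ring
  calc _ = eikonalSum u a N m x * eikonalSum u a N m x +
        eikonalSum u a N m x * fderiv ℝ (eikonalSum u a N m) x (x - a) +
        eikonalSum u a N m x * fderiv ℝ (eikonalSum u a N m) x (x - a) + ‖x - a‖ ^ 2 *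
        inner ℝ (gradient (eikonalSum u a N m) x) (gradient (eikonalSum u a N m) x) := rfl
    _ = _ := by
      -- The two equal cross terms are expanded with the roles of `p` and `q` exchanged, matching
      -- the two mixed terms of `eikonalProduct`.
      nth_rewrite 1 [h2]
      rw [h3, h1, hi]
      simp only [Finset.mul_sum, ← Finset.sum_add_distrib]
      refine Finset.sum_congr rfl fun p _ => Finset.sum_congr rfl fun q _ => ?_
      unfold eikonalProduct
      ring

end Eikonal

/-! ### The defect of the truncated solution, and uniform bounds near the segment. -/

section Defect

/-- Grouping by total degree: degrees at most `N` are settled by the eikonal equation order by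
order, and the higher ones enter the defect. -/
theorem sum_sum_pow_mul_eq (N : ℕ) (m : ℝ) (f : ℕ → ℕ → ℝ) :
    ∑ p ∈ Finset.range (N + 1), ∑ q ∈ Finset.range (N + 1), m ^ (p + q) * f p q =
      ∑ k ∈ Finset.range (N + 1), m ^ k * ∑ p ∈ Finset.range (k + 1), f p (k - p) +
      m ^ (N + 1) * ∑ p ∈ Finset.range (N + 1), ∑ q ∈ Finset.range (N + 1),
        if N < p + q then m ^ (p + q - (N + 1)) * f p q else 0 := by
  have h1 : ∑ k ∈ Finset.range (N + 1), m ^ k * ∑ p ∈ Finset.range (k + 1), f p (k - p) =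
      ∑ p ∈ Finset.range (N + 1), ∑ q ∈ Finset.range (N + 1),
        if N < p + q then 0 else m ^ (p + q) * f p q := by
    simp only [Finset.mul_sum]
    rw [Finset.sum_sigma', ← Finset.sum_product', Finset.sum_ite, Finset.sum_const_zero, zero_add]
    refine Finset.sum_nbij' (fun z => (z.2, z.1 - z.2)) (fun z => ⟨z.1 + z.2, z.1⟩) ?_ ?_ ?_ ?_ ?_
    · rintro ⟨k, p⟩ h
      simp at h ⊢; omega
    · rintro ⟨p, q⟩ h
      simp at h ⊢; omega
    · rintro ⟨k, p⟩ h
      simp at h ⊢; omega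
    · rintro ⟨p, q⟩ h
      simp
    · rintro ⟨k, p⟩ h
      simp at h ⊢
      rw [Nat.add_sub_cancel' (by omega)]
      exact Or.inl rfl
  rw [h1, Finset.mul_sum, ← Finset.sum_add_distrib]
  refine Finset.sum_congr rfl fun p _ => ?_
  rw [Finset.mul_sum, ← Finset.sum_add_distrib]
  refine Finset.sum_congr rfl fun q _ => ?_
  split_ifs with h
  · rw [zero_add, ← mul_assoc, ← pow_add, Nat.add_sub_cancel' h]
  · simp

theorem inner_fderiv_gradient_comm {Ω : E3 → ℝ} {x : E3} (hΩ : ContDiffAt ℝ 2 Ω x) (b w : E3) :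
    inner ℝ (fderiv ℝ (gradient Ω) x b) w = inner ℝ (fderiv ℝ (gradient Ω) x w) b := by
  have hs := hΩ.isSymmSndFDerivAt (by simp)
  have hd : DifferentiableAt ℝ (fderiv ℝ Ω) x :=
    (hΩ.fderiv_right (m := 1) (by norm_num)).differentiableAt (by simp)
  have hg : DifferentiableAt ℝ (gradient Ω) x :=
    ((InnerProductSpace.toDual ℝ E3).symm.toContinuousLinearEquiv.differentiableAt).comp x hd
  have key : ∀ b w : E3, inner ℝ (fderiv ℝ (gradient Ω) x b) w = fderiv ℝ (fderiv ℝ Ω) x b w := by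
    intro b w
    have h1 := hg.hasFDerivAt.inner ℝ (hasFDerivAt_const w x)
    have h2 := hd.hasFDerivAt.clm_apply (hasFDerivAt_const w x)
    simp only [inner_gradient_left] at h1
    have h3 := congrArg (fun l : E3 →L[ℝ] ℝ => l b) (h1.unique h2)
    simpa using h3
  rw [key, key]
  exact hs b w

/-- The derivative of the perturbed eikonal equation. -/
theorem fderiv_gradient_apply_gradient {Ω U d : E3 → ℝ} {x : E3} {μ : ℝ}
    (hΩ : ContDiffAt ℝ 2 Ω x) (hU : DifferentiableAt ℝ U x) (hd : DifferentiableAt ℝ d x)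
    (heik : ∀ᶠ y in 𝓝 x, ‖gradient Ω y‖ ^ 2 = 2 * Ω y * U y + μ * d y) :
    fderiv ℝ (gradient Ω) x (gradient Ω x) =
      U x • gradient Ω x + Ω x • gradient U x + μ • ((1 / 2 : ℝ) • gradient d x) := by
  have hg : DifferentiableAt ℝ (gradient Ω) x :=
    ((InnerProductSpace.toDual ℝ E3).symm.toContinuousLinearEquiv.differentiableAt).comp x
      ((hΩ.fderiv_right (m := 1) (by norm_num)).differentiableAt (by simp))
  have hΩ' : DifferentiableAt ℝ Ω x := hΩ.differentiableAt (by simp)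
  have h1 := hg.hasFDerivAt.norm_sq
  have h2 := ((hΩ'.hasFDerivAt.const_mul 2).mul hU.hasFDerivAt).add (hd.hasFDerivAt.const_mul μ)
  have h3 := h1.unique (h2.congr_of_eventuallyEq heik)
  refine ext_inner_right ℝ fun b => ?_
  have h4 := congrArg (fun l : E3 →L[ℝ] ℝ => l b) h3
  simp at h4
  -- Differentiating `|∇Ω|²` gives `2 ⟨H b, ∇Ω⟩`; symmetry of the Hessian turns this into `2 ⟨H ∇Ω,
  -- b⟩`.
  rw [inner_fderiv_gradient_comm hΩ, real_inner_comm]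
  simp only [inner_add_left, inner_smul_left, inner_gradient_left, RCLike.conj_to_real] at h4 ⊢
  linarith

variable {D : Set E3} {a : E3}

/-- The defect of the truncated formal solution in the eikonal equation, divided by
`m ^ (N + 1) ‖x - a‖ ^ 2`. -/
def eikonalDefect (u : ℕ → ℝ) (h : ℝ → ℝ) (a : E3) (N : ℕ) (m : ℝ) (x : E3) : ℝ :=
  eikonalSum u a N m x ^ 2 * ((∑ p ∈ Finset.range (N + 1), ∑ q ∈ Finset.range (N + 1),
    if N < p + q then m ^ (p + q - (N + 1)) *
      eikonalProduct a (eikonalTerm u a p) (eikonalTerm u a q) x else 0) -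
    h (m / ‖x‖) / ‖x‖ ^ (N + 1))

theorem isOpen_setOf_div_norm_mem (hDo : IsOpen D) (hD0 : (0 : E3) ∉ D) (t₀ : ℝ) :
    IsOpen {q : ℝ × E3 | q.2 ∈ D ∧ q.1 / ‖q.2‖ ∈ Ioo (-t₀) t₀} := by
  have hne : ∀ q ∈ (univ : Set ℝ) ×ˢ D, ‖q.2‖ ≠ 0 := fun q hq =>
    norm_ne_zero_iff.2 fun h0 => hD0 (h0 ▸ hq.2)
  have hc : ContinuousOn (fun q : ℝ × E3 => q.1 / ‖q.2‖) (univ ×ˢ D) :=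
    continuousOn_fst.div continuousOn_snd.norm hne
  have := hc.isOpen_inter_preimage (isOpen_univ.prod hDo) (isOpen_Ioo (a := -t₀) (b := t₀))
  convert this using 1
  ext q; simp

theorem contDiffOn_comp_div_norm (hD0 : (0 : E3) ∉ D) {t₀ : ℝ}
    {h : ℝ → ℝ} (hh : ContDiffOn ℝ ∞ h (Ioo (-t₀) t₀)) :
    ContDiffOn ℝ ∞ (fun q : ℝ × E3 => h (q.1 / ‖q.2‖))
      {q : ℝ × E3 | q.2 ∈ D ∧ q.1 / ‖q.2‖ ∈ Ioo (-t₀) t₀} := by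
  refine hh.comp ?_ fun q hq => hq.2
  have hne : ∀ q ∈ {q : ℝ × E3 | q.2 ∈ D ∧ q.1 / ‖q.2‖ ∈ Ioo (-t₀) t₀}, q.2 ≠ 0 :=
    fun q hq h0 => hD0 (h0 ▸ hq.1)
  exact contDiffOn_fst.div (contDiffOn_snd.norm ℝ hne) fun q hq => norm_ne_zero_iff.2 (hne q hq)

theorem contDiffOn_uncurry_eikonalDefect {u : ℕ → ℝ} (hDo : IsOpen D) (hD : StarConvex ℝ a D)
    (hD0 : (0 : E3) ∉ D) {t₀ : ℝ} {h : ℝ → ℝ} (hh : ContDiffOn ℝ ∞ h (Ioo (-t₀) t₀)) (N : ℕ) :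
    ContDiffOn ℝ ∞ (Function.uncurry (eikonalDefect u h a N))
      {q : ℝ × E3 | q.2 ∈ D ∧ q.1 / ‖q.2‖ ∈ Ioo (-t₀) t₀} := by
  have hsub : {q : ℝ × E3 | q.2 ∈ D ∧ q.1 / ‖q.2‖ ∈ Ioo (-t₀) t₀} ⊆ univ ×ˢ D :=
    fun q hq => ⟨trivial, hq.1⟩
  have hne : ∀ q ∈ {q : ℝ × E3 | q.2 ∈ D ∧ q.1 / ‖q.2‖ ∈ Ioo (-t₀) t₀}, q.2 ≠ 0 :=
    fun q hq h0 => hD0 (h0 ▸ hq.1)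
  have h1 := ((contDiffOn_uncurry_eikonalSum (u := u) hDo hD hD0 N).mono hsub).pow 2
  have h2 : ContDiffOn ℝ ∞ (fun q : ℝ × E3 => ∑ p ∈ Finset.range (N + 1),
      ∑ r ∈ Finset.range (N + 1), if N < p + r then q.1 ^ (p + r - (N + 1)) *
      eikonalProduct a (eikonalTerm u a p) (eikonalTerm u a r) q.2 else 0)
      {q : ℝ × E3 | q.2 ∈ D ∧ q.1 / ‖q.2‖ ∈ Ioo (-t₀) t₀} := by
    refine ContDiffOn.sum fun p _ => ContDiffOn.sum fun r _ => ?_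
    split_ifs
    · refine (contDiffOn_fst.pow _).mul ?_
      exact (contDiffOn_eikonalProduct hDo (contDiffOn_eikonalTerm hDo hD hD0 p)
        (contDiffOn_eikonalTerm hDo hD hD0 r)).comp contDiffOn_snd fun q hq => hq.1
    · exact contDiffOn_const
  exact h1.mul (h2.sub ((contDiffOn_comp_div_norm hD0 hh).div ((contDiffOn_snd.norm ℝ hne).pow _)
    fun q hq => pow_ne_zero _ (norm_ne_zero_iff.2 (hne q hq))))

theorem norm_gradient_worldFunction_sq_eq {P : PNParameters} (hDo : IsOpen D)
    (hD : StarConvex ℝ a D) (hD0 : (0 : E3) ∉ D) {N : ℕ} {h : ℝ → ℝ} {m : ℝ} {x : E3} (hx : x ∈ D)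
    (hexp : P.ratio (m / ‖x‖) = ∑ k ∈ Finset.range (N + 1), P.uCoeff k * (m / ‖x‖) ^ k +
      (m / ‖x‖) ^ (N + 1) * h (m / ‖x‖)) :
    ‖gradient (worldFunction P.uCoeff a N m) x‖ ^ 2 =
      2 * worldFunction P.uCoeff a N m x * P.potU m ‖x‖ +
        m ^ (N + 1) * (‖x - a‖ ^ 2 * eikonalDefect P.uCoeff h a N m x) := by
  have hdiff : DifferentiableAt ℝ (eikonalSum P.uCoeff a N m) x := by
    have h1 : ContDiffAt ℝ ∞ (Function.uncurry (eikonalSum P.uCoeff a N)) (m, x) :=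
      (contDiffOn_uncurry_eikonalSum hDo hD hD0 N).contDiffAt
        ((isOpen_univ.prod hDo).mem_nhds ⟨trivial, hx⟩)
    have h2 : DifferentiableAt ℝ (Function.uncurry (eikonalSum P.uCoeff a N)) (m, x) :=
      h1.differentiableAt (by simp)
    exact h2.comp (f := fun y : E3 => (m, y)) x (by fun_prop)
  rw [norm_gradient_worldFunction_sq hdiff, eikonalProduct_eikonalSum hDo hD hD0 N m hx,
    sum_sum_pow_mul_eq, P.potU_eq, hexp]
  simp only [sum_eikonalProduct hDo hD hD0 P.uCoeff_zero _ hx]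
  have hs : ∑ k ∈ Finset.range (N + 1), m ^ k * (P.uCoeff k / ‖x‖ ^ k) =
      ∑ k ∈ Finset.range (N + 1), P.uCoeff k * (m / ‖x‖) ^ k :=
    Finset.sum_congr rfl fun k _ => by rw [div_pow]; ring
  rw [hs, eikonalDefect, worldFunction, div_pow m ‖x‖ (N + 1)]
  ring

/-- Uniform bounds, near a compact set and for small `m`, for the refractive index and for the
truncated formal solution of the eikonal equation. -/
theorem exists_uniform_bounds {P : PNParameters} {ρ : ℝ} (hreg : P.IsRegular ρ) (hDo : IsOpen D)
    (hD : StarConvex ℝ a D) (hD0 : (0 : E3) ∉ D) {K : Set E3} (hK : IsCompact K) (hKD : K ⊆ D)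
    (N : ℕ) :
    ∃ (m₁ C : ℝ) (d : ℝ → E3 → ℝ) (d' : ℝ → E3 → E3), 0 < m₁ ∧ 0 ≤ C ∧
      ∀ m ∈ Icc 0 m₁, ∀ x ∈ K,
        |P.potU m ‖x‖ - 1| ≤ C * m ∧
        ‖gradient (fun y : E3 => P.potU m ‖y‖) x‖ ≤ C * m ∧
        DifferentiableAt ℝ (gradient (worldFunction P.uCoeff a N m)) x ∧
        (∀ b, ‖fderiv ℝ (gradient (worldFunction P.uCoeff a N m)) x b - b‖ ≤ C * m * ‖b‖) ∧
        ‖gradient (worldFunction P.uCoeff a N m) x‖ ≤ C ∧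
        |d m x| ≤ C * ‖x - a‖ ∧ ‖d' m x‖ ≤ C * ‖x - a‖ ∧
        |eikonalSum P.uCoeff a N m x - 1| ≤ C * m ∧
        ‖gradient (worldFunction P.uCoeff a N m) x‖ ^ 2 =
          2 * worldFunction P.uCoeff a N m x * P.potU m ‖x‖ + m ^ (N + 1) * d m x ∧
        fderiv ℝ (gradient (worldFunction P.uCoeff a N m)) x
            (gradient (worldFunction P.uCoeff a N m) x) =
          P.potU m ‖x‖ • gradient (worldFunction P.uCoeff a N m) x +
          worldFunction P.uCoeff a N m x • gradient (fun y : E3 => P.potU m ‖y‖) x +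
          m ^ (N + 1) • d' m x := by
  obtain ⟨t₀, ht₀, hratio, h, hh, hexp⟩ := P.exists_ratio_expansion hreg N
  obtain ⟨r₀, hr₀, hr₀K⟩ := hK.exists_forall_le' (f := fun x : E3 => ‖x‖) (a := 0)
    continuous_norm.continuousOn
    fun x hx => norm_pos_iff.2 fun h0 => hD0 (h0 ▸ hKD hx)
  set O : Set (ℝ × E3) := {q : ℝ × E3 | q.2 ∈ D ∧ q.1 / ‖q.2‖ ∈ Ioo (-t₀) t₀} with hOdef
  have hOo : IsOpen O := isOpen_setOf_div_norm_mem hDo hD0 t₀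
  have hOD : O ⊆ univ ×ˢ D := fun q hq => ⟨trivial, hq.1⟩
  have hm₁ : 0 < t₀ * r₀ / 2 := by positivity
  have hKO : Icc 0 (t₀ * r₀ / 2) ×ˢ K ⊆ O := by
    rintro ⟨m, x⟩ ⟨hm, hx⟩
    have hx0 := hr₀K x hx
    have hxp : 0 < ‖x‖ := hr₀.trans_le hx0
    have h1 : 0 ≤ m / ‖x‖ := div_nonneg hm.1 hxp.le
    refine ⟨hKD hx, by simp only; linarith, ?_⟩
    simp only
    rw [div_lt_iff₀ hxp]
    have := hm.2
    simp only at this hx0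
    nlinarith
  set u := P.uCoeff with hu
  let f₁ : ℝ → E3 → ℝ := fun m x => P.potU m ‖x‖
  let G : ℝ → E3 → E3 := fun m x => gradient (worldFunction u a N m) x
  let ψ : ℝ → E3 → ℝ := eikonalDefect u h a N
  have hf₁ : ContDiffOn ℝ ∞ (Function.uncurry f₁) O := contDiffOn_comp_div_norm hD0 hratio
  have hΩ : ContDiffOn ℝ ∞ (Function.uncurry (worldFunction u a N)) O :=
    (contDiffOn_uncurry_worldFunction hDo hD hD0 N).mono hOD
  have hG : ContDiffOn ℝ ∞ (Function.uncurry G) O :=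
    (InnerProductSpace.toDual ℝ E3).symm.contDiff.comp_contDiffOn (contDiffOn_partialSnd hOo hΩ)
  have hψ : ContDiffOn ℝ ∞ (Function.uncurry ψ) O := contDiffOn_uncurry_eikonalDefect hDo hD hD0 hh N
  have hS : ContDiffOn ℝ ∞ (Function.uncurry (eikonalSum u a N)) O :=
    (contDiffOn_uncurry_eikonalSum hDo hD hD0 N).mono hOD
  have hr : ContDiffOn ℝ ∞ (Function.uncurry fun (_ : ℝ) (x : E3) => x - a) O := by
    change ContDiffOn ℝ ∞ (fun q : ℝ × E3 => q.2 - a) O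
    fun_prop
  obtain ⟨C₁, hC₁, h₁⟩ := exists_norm_sub_le_mul_of_contDiffOn hK hOo hKO hf₁
  obtain ⟨C₂, hC₂, h₂⟩ :=
    exists_norm_sub_le_mul_of_contDiffOn hK hOo hKO (contDiffOn_partialSnd hOo hf₁)
  obtain ⟨C₃, hC₃, h₃⟩ :=
    exists_norm_sub_le_mul_of_contDiffOn hK hOo hKO (contDiffOn_partialSnd hOo hG)
  obtain ⟨C₄, hC₄, h₄⟩ := exists_norm_le_of_contDiffOn hK hKO hG
  obtain ⟨C₅, hC₅, h₅⟩ := exists_norm_le_of_contDiffOn hK hKO hψ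
  obtain ⟨C₆, hC₆, h₆⟩ := exists_norm_le_of_contDiffOn hK hKO (contDiffOn_partialSnd hOo hψ)
  obtain ⟨C₇, hC₇, h₇⟩ := exists_norm_sub_le_mul_of_contDiffOn hK hOo hKO hS
  obtain ⟨R, hR, h₈⟩ := exists_norm_le_of_contDiffOn hK hKO hr
  -- The factor `‖x - a‖ ^ 2` makes both `d` and its gradient `O(‖x - a‖)`, hence `O(ξ)` along a
  -- ray, as the singular inequality requires.
  let d : ℝ → E3 → ℝ := fun m x => ‖x - a‖ ^ 2 * ψ m x
  let d' : ℝ → E3 → E3 := fun m x => (1 / 2 : ℝ) • gradient (d m) x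
  set C := C₁ + C₂ + C₃ + C₄ + R * C₅ + (C₅ + R * C₆) + C₇ with hCdef
  have hR5 : 0 ≤ R * C₅ := by positivity
  have hR6 : 0 ≤ R * C₆ := by positivity
  have hpot0 : ∀ x : E3, f₁ 0 x = 1 := by
    intro x
    have := hexp 0 ⟨by linarith, ht₀⟩
    rw [Finset.sum_eq_single_of_mem 0 (by simp) (fun k _ hk => by simp [hk])] at this
    simpa [f₁, P.potU_eq, hu, P.uCoeff_zero] using this
  have hG0 : G 0 = fun y => y - a := by
    funext x
    have hc : eikonalSum u a N 0 = fun _ => 1 := funext (eikonalSum_zero_right N)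
    have : gradient (fun _ : E3 => (1 : ℝ)) x = 0 := by simp [gradient]
    simp only [G]
    rw [gradient_worldFunction (by rw [hc]; exact differentiableAt_const _), hc, this]
    simp
  refine ⟨t₀ * r₀ / 2, C, d, d', hm₁, by positivity, fun m hm x hx => ?_⟩
  have hmx : (m, x) ∈ O := hKO ⟨hm, hx⟩
  have hslice : ∀ {V : Type} [NormedAddCommGroup V] [NormedSpace ℝ V] {f : ℝ → E3 → V},
      ContDiffOn ℝ ∞ (Function.uncurry f) O → ContDiffAt ℝ ∞ (f m) x := by
    intro V _ _ f hf
    exact ContDiffAt.comp (f := fun y : E3 => (m, y)) x (hf.contDiffAt (hOo.mem_nhds hmx))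
      (by fun_prop)
  have hdψ : DifferentiableAt ℝ (ψ m) x := (hslice hψ).differentiableAt (by simp)
  have hrx : ‖x - a‖ ≤ R := h₈ m hm x hx
  have hdf : HasFDerivAt (d m) (‖x - a‖ ^ 2 • fderiv ℝ (ψ m) x +
      ψ m x • ((2 : ℝ) • innerSL ℝ (x - a))) x := by
    have h1 : HasFDerivAt (fun y : E3 => ‖y - a‖ ^ 2) ((2 : ℝ) • innerSL ℝ (x - a)) x := by
      refine (((hasFDerivAt_id x).sub_const a).norm_sq).congr_fderiv ?_
      ext w; simp
    exact h1.mul hdψ.hasFDerivAt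
  have heik : ∀ y, (m, y) ∈ O → ‖gradient (worldFunction u a N m) y‖ ^ 2 =
      2 * worldFunction u a N m y * P.potU m ‖y‖ + m ^ (N + 1) * d m y := fun y hy =>
    norm_gradient_worldFunction_sq_eq hDo hD hD0 hy.1 (hexp _ hy.2)
  have heik' : ∀ᶠ y in 𝓝 x, ‖gradient (worldFunction u a N m) y‖ ^ 2 =
      2 * worldFunction u a N m y * P.potU m ‖y‖ + m ^ (N + 1) * d m y := by
    have hcont : ContinuousAt (fun y : E3 => (m, y)) x := by fun_prop
    filter_upwards [hcont.eventually (hOo.mem_nhds hmx)] with y hy using heik y hy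
  have hm0 := hm.1
  refine ⟨?_, ?_, (hslice hG).differentiableAt (by simp), fun b => ?_, ?_, ?_, ?_, ?_,
    heik x hmx, ?_⟩
  · have := h₁ m hm x hx
    rw [hpot0, Real.norm_eq_abs] at this
    refine this.trans ?_
    gcongr
    linarith
  · have := h₂ m hm x hx
    have h0 : partialSnd f₁ 0 x = 0 := by
      have : f₁ 0 = fun _ => 1 := funext hpot0
      simp [partialSnd, this]
    rw [h0, sub_zero] at this
    rw [norm_gradient]
    refine this.trans ?_
    gcongr
    linarith
  · have := h₃ m hm x hx
    have h0 : partialSnd G 0 x = ContinuousLinearMap.id ℝ E3 := by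
      rw [partialSnd, hG0]
      exact ((hasFDerivAt_id x).sub_const a).fderiv
    rw [h0] at this
    have h9 := (partialSnd G m x - ContinuousLinearMap.id ℝ E3).le_of_opNorm_le this b
    refine (show _ ≤ _ from h9).trans ?_
    gcongr
    linarith
  · exact (h₄ m hm x hx).trans (by linarith)
  · have := h₅ m hm x hx
    rw [abs_mul, abs_of_nonneg (by positivity), sq]
    calc ‖x - a‖ * ‖x - a‖ * |ψ m x| ≤ ‖x - a‖ * R * C₅ := by gcongr; exact this
      _ = R * C₅ * ‖x - a‖ := by ring
      _ ≤ C * ‖x - a‖ := by gcongr; linarith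
  · have h5 := h₅ m hm x hx
    have h6 := h₆ m hm x hx
    rw [norm_smul, norm_gradient, hdf.fderiv]
    have n1 := norm_add_le (‖x - a‖ ^ 2 • fderiv ℝ (ψ m) x) (ψ m x • ((2 : ℝ) • innerSL ℝ (x - a)))
    have n2 : ‖‖x - a‖ ^ 2 • fderiv ℝ (ψ m) x‖ ≤ ‖x - a‖ * R * C₆ := by
      rw [norm_smul, norm_pow, norm_norm, sq]
      gcongr
      exact h6
    have n3 : ‖ψ m x • ((2 : ℝ) • innerSL ℝ (x - a))‖ ≤ C₅ * (2 * ‖x - a‖) := by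
      rw [norm_smul, norm_smul, innerSL_apply_norm]
      simp only [Real.norm_ofNat]
      gcongr
    have h12 : ‖(1 / 2 : ℝ)‖ = 1 / 2 := by norm_num
    rw [h12]
    have hx0 := norm_nonneg (x - a)
    have : (C₅ + R * C₆) * ‖x - a‖ ≤ C * ‖x - a‖ := by gcongr; linarith
    have h7 : 0 ≤ R * C₆ * ‖x - a‖ := by positivity
    nlinarith
  · have := h₇ m hm x hx
    rw [eikonalSum_zero_right, Real.norm_eq_abs] at this
    refine this.trans ?_
    gcongr
    linarith
  · exact fderiv_gradient_apply_gradient ((hslice hΩ).of_le ENat.LEInfty.out)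
      ((hslice hf₁).differentiableAt (by simp)) hdf.differentiableAt heik'

end Defect

/-! ### Null geodesics and identification of the coefficients of the transfer time. -/

section Rays

/-- Needed at every radius beyond `ρ m`, since a ray is not known in advance to stay where `m / r`
is small. Convergence at an intermediate radius `r` makes `m / ‖x‖` interior to the interval of
convergence. -/
theorem PNParameters.differentiableAt_potU_norm {P : PNParameters} {ρ : ℝ} (hreg : P.IsRegular ρ)
    {m : ℝ} (hm : 0 < m) {x : E3} (hx : ρ * m < ‖x‖) :
    DifferentiableAt ℝ (fun y : E3 => P.potU m ‖y‖) x := by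
  obtain ⟨hρ, hreg⟩ := hreg
  have hρm : 0 < ρ * m := mul_pos hρ hm
  have hxp : 0 < ‖x‖ := hρm.trans hx
  set r := (ρ * m + ‖x‖) / 2 with hr
  have hrρ : ρ * m < r := by rw [hr]; linarith
  have hrx : r < ‖x‖ := by rw [hr]; linarith
  have hrp : 0 < r := hρm.trans hrρ
  obtain ⟨ha, hb, -, -⟩ := hreg m r hm hrρ
  have hA := contDiffOn_tsum_pow (div_pos hm hrp) ha
  have hB := contDiffOn_tsum_pow (div_pos hm hrp) hb
  have hmem : Ioo (-(m / r)) (m / r) ∈ 𝓝 (m / ‖x‖) := by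
    have h1 : 0 < m / ‖x‖ := div_pos hm hxp
    have h2 : m / ‖x‖ < m / r := by gcongr
    exact Ioo_mem_nhds (by linarith) h2
  have hpos := (hreg m ‖x‖ hm hx).2.2.1
  have hratio : DifferentiableAt ℝ P.ratio (m / ‖x‖) :=
    ((hB.contDiffAt hmem).differentiableAt (by simp)).div
      ((hA.contDiffAt hmem).differentiableAt (by simp)) hpos.ne'
  have hn : DifferentiableAt ℝ (fun y : E3 => ‖y‖) x :=
    DifferentiableAt.norm ℝ differentiableAt_fun_id (norm_pos_iff.1 hxp)
  have hnorm : DifferentiableAt ℝ (fun y : E3 => m / ‖y‖) x := by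
    simpa only [div_eq_mul_inv] using (hn.fun_inv hxp.ne').const_mul m
  exact hratio.comp x hnorm

theorem hasDerivWithinAt_of_inner {f : ℝ → E3} {f' : E3} {s : Set ℝ} {ξ : ℝ}
    (h : ∀ w, HasDerivWithinAt (fun t => inner ℝ (f t) w) (inner ℝ f' w) s ξ) :
    HasDerivWithinAt f f' s ξ := by
  let b := EuclideanSpace.basisFun (Fin 3) ℝ
  have hrep : ∀ v : E3, ∑ i, inner ℝ v (b i) • b i = v := by
    intro v
    simpa only [real_inner_comm] using b.sum_repr' v
  have := HasDerivWithinAt.fun_sum (u := Finset.univ) fun i _ => (h (b i)).smul_const (b i)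
  simpa only [hrep] using this

/-- The first integrals and the momentum equation of a null geodesic of the conformal metric. -/
theorem IsNullGeodesic.exists_momentum {P : PNParameters} {ρ : ℝ} (hreg : P.IsRegular ρ)
    {m : ℝ} (hm : 0 < m) {x0 : ℝ → ℝ} {x : ℝ → E3} (hx : ∀ ξ ∈ Icc (0 : ℝ) 1, ρ * m < ‖x ξ‖)
    (hgeo : IsNullGeodesic (conformalMetric (P.potU m)) fun ξ => (x0 ξ, x ξ)) :
    ∃ v : ℝ → E3,
      (∀ ξ ∈ Icc (0 : ℝ) 1, HasDerivWithinAt x (v ξ) (Icc 0 1) ξ) ∧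
      (∀ ξ ∈ Icc (0 : ℝ) 1, HasDerivWithinAt (fun s => P.potU m ‖x s‖ • v s)
        ((1 / 2 * ‖v ξ‖ ^ 2) • gradient (fun y : E3 => P.potU m ‖y‖) (x ξ)) (Icc 0 1) ξ) ∧
      ∀ ξ ∈ Icc (0 : ℝ) 1, (x0 1 - x0 0) ^ 2 = P.potU m ‖x ξ‖ * ‖v ξ‖ ^ 2 := by
  obtain ⟨v, hv⟩ := hgeo
  have hfd : ∀ ξ ∈ Icc (0 : ℝ) 1, ∀ w : Event,
      fderiv ℝ (fun y => conformalMetric (P.potU m) y (v ξ) (v ξ)) (x0 ξ, x ξ) w =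
        -(‖(v ξ).2‖ ^ 2 * inner ℝ (gradient (fun y : E3 => P.potU m ‖y‖) (x ξ)) w.2) := by
    intro ξ hξ w
    have h1 := (PNParameters.differentiableAt_potU_norm hreg hm (hx ξ hξ)).hasFDerivAt
    have h2 : HasFDerivAt (fun y : Event => P.potU m ‖y.2‖)
        ((fderiv ℝ (fun y : E3 => P.potU m ‖y‖) (x ξ)).comp (ContinuousLinearMap.snd ℝ ℝ E3))
        (x0 ξ, x ξ) :=
      HasFDerivAt.comp (g := fun y : E3 => P.potU m ‖y‖) (f := fun y : Event => y.2) (x0 ξ, x ξ)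
        h1 hasFDerivAt_snd
    have h3 := (h2.mul_const (inner ℝ (v ξ).2 (v ξ).2)).const_sub ((v ξ).1 * (v ξ).1)
    have h4 : fderiv ℝ (fun y => conformalMetric (P.potU m) y (v ξ) (v ξ)) (x0 ξ, x ξ) = _ :=
      h3.fderiv
    rw [h4]
    simp
  -- The metric does not depend on `x⁰`, so the component of the geodesic equation along `(1, 0)` is
  -- a conservation law.
  have hconst : ∀ ξ ∈ Icc (0 : ℝ) 1, (v ξ).1 = (v 0).1 := by
    intro ξ hξ
    have := norm_image_sub_le_of_norm_deriv_le_segment' (f := fun s => (v s).1) (f' := fun _ => 0)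
      (C := 0) (a := 0) (b := 1) (fun s hs => by
        have h := (hv s hs).2.2.2 ((1 : ℝ), (0 : E3))
        rw [hfd s hs] at h
        simpa [conformalMetric] using h) (fun s _ => by simp) ξ hξ
    simpa [sub_eq_zero] using this
  have hx0 : x0 1 - x0 0 = (v 0).1 := by
    have := norm_image_sub_le_of_norm_deriv_le_segment' (f := fun s => x0 s - s * (v 0).1)
      (f' := fun s => 0) (C := 0) (a := 0) (b := 1) (fun s hs => by
        have h1 : HasDerivWithinAt x0 (v s).1 (Icc 0 1) s := (hv s hs).1.fst
        have h2 : HasDerivWithinAt (fun s : ℝ => s * (v 0).1) (1 * (v 0).1) (Icc 0 1) s :=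
          (hasDerivWithinAt_id s _).mul_const _
        refine (h1.sub h2).congr_deriv ?_
        rw [hconst s hs]; ring) (fun s _ => by simp) 1 ⟨zero_le_one, le_rfl⟩
    simp only [zero_mul, one_mul, sub_zero, mul_one, norm_le_zero_iff] at this
    linarith
  refine ⟨fun ξ => (v ξ).2, fun ξ hξ => (hv ξ hξ).1.snd, fun ξ hξ => ?_, fun ξ hξ => ?_⟩
  · refine hasDerivWithinAt_of_inner fun w => ?_
    have h := ((hv ξ hξ).2.2.2 ((0 : ℝ), w)).neg
    rw [hfd ξ hξ] at h
    refine (h.congr (fun t _ => ?_) ?_).congr_deriv ?_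
    · simp [conformalMetric, inner_smul_left]
    · simp [conformalMetric, inner_smul_left]
    · simp only [inner_smul_left, RCLike.conj_to_real]
      ring
  · have h := (hv ξ hξ).2.2.1
    simp only [conformalMetric, real_inner_self_eq_norm_sq, hconst ξ hξ] at h
    rw [hx0]
    linarith

/-- Of the expansions only the end values and the initial velocity are kept. The expansions converge
pointwise in `ξ`; uniformity in `ξ` will come from the geodesic equation. -/
theorem IsQuasiMinkowskianRay.exists_momentum {P : PNParameters} {ρ : ℝ} (hreg : P.IsRegular ρ)
    {c tA : ℝ} {xA xB : E3} {X0 : ℕ → ℝ → ℝ} {X : ℕ → ℝ → E3}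
    (hray : IsQuasiMinkowskianRay P ρ c tA xA xB X0 X) :
    ∃ (m₀ : ℝ) (Y : ℕ → E3), 0 < m₀ ∧ ∀ m : ℝ, 0 < m → m < m₀ → ∃ (x v : ℝ → E3) (s : ℝ),
      HasSum (fun n : ℕ => m ^ (n + 1) • X0 (n + 1) 1) s ∧
      HasSum (fun n : ℕ => m ^ (n + 1) • Y n) (v 0 - (xB - xA)) ∧
      x 0 = xA ∧ x 1 = xB ∧
      (∀ ξ ∈ Icc (0 : ℝ) 1, HasDerivWithinAt x (v ξ) (Icc 0 1) ξ) ∧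
      (∀ ξ ∈ Icc (0 : ℝ) 1, HasDerivWithinAt (fun s => P.potU m ‖x s‖ • v s)
        ((1 / 2 * ‖v ξ‖ ^ 2) • gradient (fun y : E3 => P.potU m ‖y‖) (x ξ)) (Icc 0 1) ξ) ∧
      ∀ ξ ∈ Icc (0 : ℝ) 1, (‖xB - xA‖ + s) ^ 2 = P.potU m ‖x ξ‖ * ‖v ξ‖ ^ 2 := by
  obtain ⟨hbd, m₀, hm₀, H⟩ := hray
  have h0 : (0 : ℝ) ∈ Icc (0 : ℝ) 1 := ⟨le_rfl, zero_le_one⟩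
  have h1 : (1 : ℝ) ∈ Icc (0 : ℝ) 1 := ⟨zero_le_one, le_rfl⟩
  refine ⟨m₀, fun n => iteratedDerivWithin 1 (X (n + 1)) (Icc 0 1) 0, hm₀, fun m hm hmm => ?_⟩
  obtain ⟨x0, x, hE0, hE, hr, hgeo⟩ := H m hm hmm
  obtain ⟨v, hx, hP, hnull⟩ := hgeo.exists_momentum hreg hm hr
  have e00 := hE0.2.2 0 (by norm_num) 0 h0
  have e01 := hE0.2.2 0 (by norm_num) 1 h1
  have f00 := hE.2.2 0 (by norm_num) 0 h0
  have f01 := hE.2.2 0 (by norm_num) 1 h1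
  have f10 := hE.2.2 1 (by norm_num) 0 h0
  simp only [iteratedDerivWithin_zero, (hbd _ (Nat.succ_le_succ (Nat.zero_le _))).1,
    (hbd _ (Nat.succ_le_succ (Nat.zero_le _))).2.1, (hbd _ (Nat.succ_le_succ (Nat.zero_le _))).2.2,
    smul_zero] at e00 e01 f00 f01
  have e00' := e00.unique hasSum_zero
  have f00' := f00.unique hasSum_zero
  have f01' := f01.unique hasSum_zero
  simp only [seg, zero_smul, add_zero, sub_eq_zero, one_smul, add_sub_cancel] at f00' f01'
  simp only [zero_mul, add_zero] at e00'
  refine ⟨x, v, _, e01, ?_, f00', f01', hx, hP, fun ξ hξ => ?_⟩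
  · have hseg : HasDerivWithinAt (fun ξ : ℝ => seg xA xB ξ) (xB - xA) (Icc 0 1) 0 := by
      simpa [seg] using
        (((hasDerivAt_id (0 : ℝ)).smul_const (xB - xA)).const_add xA).hasDerivWithinAt
    have hder : iteratedDerivWithin 1 (fun ξ => x ξ - seg xA xB ξ) (Icc 0 1) 0 =
        v 0 - (xB - xA) := by
      rw [iteratedDerivWithin_one]
      exact ((hx 0 h0).sub hseg).derivWithin (uniqueDiffOn_Icc zero_lt_one 0 h0)
    rw [← hder]
    exact f10
  · rw [← hnull ξ hξ]
    congr 1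
    linarith

/-- The time of transfer agrees with the truncated formal solution of the eikonal equation. -/
theorem IsQuasiMinkowskianRay.exists_abs_sub_le {P : PNParameters} {ρ : ℝ}
    (hreg : P.IsRegular ρ) {c tA : ℝ} {xA xB : E3} {D : Set E3} (hDo : IsOpen D)
    (hD : StarConvex ℝ xA D) (hD0 : (0 : E3) ∉ D) (hB : xB ∈ D) (hBA : xB ≠ xA)
    {X0 : ℕ → ℝ → ℝ} {X : ℕ → ℝ → E3}
    (hray : IsQuasiMinkowskianRay P ρ c tA xA xB X0 X) (N : ℕ) :
    ∃ C : ℝ, ∀ᶠ m in 𝓝[>] (0 : ℝ), ∃ s : ℝ,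
      HasSum (fun n : ℕ => m ^ (n + 1) • X0 (n + 1) 1) s ∧
      |‖xB - xA‖ + s - ‖xB - xA‖ * eikonalSum P.uCoeff xA N m xB| ≤ C * m ^ (N + 1) := by
  obtain ⟨m₀, Y, hm₀, H⟩ := hray.exists_momentum hreg
  set R := ‖xB - xA‖ with hR
  have hRpos : 0 < R := norm_pos_iff.2 (sub_ne_zero.2 hBA)
  have h0 : (0 : ℝ) ∈ Icc (0 : ℝ) 1 := ⟨le_rfl, zero_le_one⟩
  have h1 : (1 : ℝ) ∈ Icc (0 : ℝ) 1 := ⟨zero_le_one, le_rfl⟩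
  obtain ⟨_, _, _, hs₀, hv₀, -⟩ := H (m₀ / 2) (by linarith) (by linarith)
  obtain ⟨Cs, hCs, hs⟩ := exists_norm_sub_sum_le_of_hasSum (half_pos hm₀) hs₀.summable 0
  obtain ⟨Cv, hCv, hv⟩ := exists_norm_sub_sum_le_of_hasSum (half_pos hm₀) hv₀.summable 0
  simp only [Finset.range_zero, Finset.sum_empty, sub_zero, zero_add, pow_one] at hs hv
  have hTc : IsCompact ((fun ξ : ℝ => xA + ξ • (xB - xA)) '' Icc 0 1) :=
    isCompact_Icc.image (by fun_prop)
  have hTD : (fun ξ : ℝ => xA + ξ • (xB - xA)) '' Icc 0 1 ⊆ D := by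
    rintro _ ⟨ξ, hξ, rfl⟩
    exact starConvex_lineMap_mem hD hB hξ
  -- A closed tube around the segment, compact and inside `D`: the set on which all bounds are
  -- uniform.
  obtain ⟨δ, hδ, hKD⟩ := hTc.exists_cthickening_subset_open hDo hTD
  obtain ⟨m₁, Cb, d, d', hm₁, hCb, hbd⟩ :=
    exists_uniform_bounds hreg hDo hD hD0 (hTc.cthickening (r := δ)) hKD N
  set K := Metric.cthickening δ ((fun ξ : ℝ => xA + ξ • (xB - xA)) '' Icc 0 1)
  have hmemK : ∀ y, ∀ ξ ∈ Icc (0 : ℝ) 1, ‖y - (xA + ξ • (xB - xA))‖ ≤ δ → y ∈ K := by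
    intro y ξ hξ hy
    exact Metric.mem_cthickening_of_dist_le y _ δ _ (mem_image_of_mem _ hξ) (by rwa [dist_eq_norm])
  -- `L` dominates `‖v‖ ≤ 2 (R + 1)`, `‖W‖ ≤ Cb` and, since `‖x ξ - xA‖ ≤ 2 (R + 1) ξ`, the defects
  -- divided by `ξ`. In `C` below, `Cb` counts twice because `H - U` compares both `H` and `U` with
  -- the identity.
  set L := 1 + 2 * (R + 1) + Cb + Cb * (2 * (R + 1)) with hL
  have hCbR : 0 ≤ Cb * (2 * (R + 1)) := by positivity
  set C := 2 * Cb + Cv with hC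
  have hC0 : 0 ≤ C := by positivity
  refine ⟨62 * L ^ 2 / R, ?_⟩
  have hpos : ∀ᶠ m in 𝓝[>] (0 : ℝ), 0 < m := self_mem_nhdsWithin
  filter_upwards [hpos, eventually_mul_lt 1 (half_pos (half_pos hm₀)), eventually_mul_lt 1 hm₁,
    eventually_mul_lt Cs (half_pos hRpos), eventually_mul_lt Cs one_pos,
    eventually_mul_lt (C * ((R + 1) ^ 2 + 4 * (R + 1) + 1)) hδ,
    eventually_mul_lt C (half_pos one_pos),
    eventually_mul_lt (2 * C + 10 * C * L) (half_pos one_pos)]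
    with m hm hmm₀ hmm₁ hmR hmone hmδ hmC hmL
  rw [one_mul] at hmm₀ hmm₁
  obtain ⟨x, v, s, hsum, hvsum, hxA, hxB, hx, hP, hnull⟩ := H m hm (by linarith)
  refine ⟨s, hsum, ?_⟩
  have hsm := hs m hm hmm₀.le s hsum
  have hvm := hv m hm hmm₀.le _ hvsum
  rw [Real.norm_eq_abs] at hsm
  have hmI : m ∈ Icc 0 m₁ := ⟨hm.le, hmm₁.le⟩
  have hle := abs_le.1 hsm
  have hCbm : Cb * m ≤ C * m := by gcongr; linarith
  have hCvm : Cv * m ≤ C * m := by gcongr; linarith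
  have he : 0 ≤ R + s := by linarith [hle.1]
  have heR : R + s ≤ R + 1 := by linarith [hle.2]
  have hxK : ∀ ξ ∈ Icc (0 : ℝ) 1, x ξ ∈ K := by
    intro ξ hξ
    refine hmemK _ ξ hξ (norm_sub_segment_lt (v := v) (U := fun y : E3 => P.potU m ‖y‖)
      (g := gradient fun y : E3 => P.potU m ‖y‖) (C := C) (ε := m) (e := R + s) hx hP hnull ?_ hδ hxA he (hvm.trans hCvm) ?_ ξ hξ).le
    · intro y ξ hξ hy
      obtain ⟨b1, b2, -⟩ := hbd m hmI y (hmemK y ξ hξ hy)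
      refine ⟨?_, b1.trans hCbm, b2.trans hCbm⟩
      have := (abs_le.1 b1).1
      linarith
    · calc C * m * ((R + s) ^ 2 + 4 * (R + s) + 1) ≤
          C * m * ((R + 1) ^ 2 + 4 * (R + 1) + 1) := by gcongr
        _ = C * ((R + 1) ^ 2 + 4 * (R + 1) + 1) * m := by ring
        _ < δ := hmδ
  have hUb : ∀ ξ ∈ Icc (0 : ℝ) 1, 1 / 2 ≤ P.potU m ‖x ξ‖ ∧ P.potU m ‖x ξ‖ ≤ 2 := by
    intro ξ hξ
    have := abs_le.1 (hbd m hmI _ (hxK ξ hξ)).1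
    constructor <;> linarith [this.1, this.2]
  have hvb : ∀ ξ ∈ Icc (0 : ℝ) 1, ‖v ξ‖ ≤ 2 * (R + 1) := by
    intro ξ hξ
    have h2 := hnull ξ hξ
    have h3 := (hUb ξ hξ).1
    have h4 : ‖v ξ‖ ^ 2 ≤ (2 * (R + s)) ^ 2 := by nlinarith [sq_nonneg ‖v ξ‖, sq_nonneg (R + s)]
    have := abs_le_of_sq_le_sq' h4 (by positivity)
    linarith [this.2]
  have hxa : ∀ ξ ∈ Icc (0 : ℝ) 1, ‖x ξ - xA‖ ≤ 2 * (R + 1) * ξ := by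
    intro ξ hξ
    have := norm_image_sub_le_of_norm_deriv_le_segment' hx
      (fun t ht => hvb t (Ico_subset_Icc_self ht)) ξ hξ
    simpa [hxA] using this
  have hmain := abs_energy_sub_le (x := x) (v := v) (U := fun y : E3 => P.potU m ‖y‖)
    (Ω := worldFunction P.uCoeff xA N m) (d := d m) (d' := d' m)
    (g := gradient fun y : E3 => P.potU m ‖y‖) (W := gradient (worldFunction P.uCoeff xA N m))
    (H := fderiv ℝ (gradient (worldFunction P.uCoeff xA N m)))
    (e := R + s) (C := C) (ε := m) (L := L) (μ := m ^ (N + 1)) hC0 hm.le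
    (by rw [hL]; linarith) (by positivity) hmL.le hx hP hnull
    (by
      -- At the emission point `Ω` and the defect both vanish, so the approximate eikonal equation
      -- forces `W = 0`.
      have hb := hbd m hmI _ (hxK 0 h0)
      have h2 := hb.2.2.2.2.2.2.2.2.1
      have h3 := hb.2.2.2.2.2.1
      have h4 : d m (x 0) = 0 := by
        rw [hxA, sub_self, norm_zero, mul_zero] at h3
        rw [hxA]
        exact abs_nonpos_iff.1 h3
      rw [h4] at h2
      have h5 : worldFunction P.uCoeff xA N m (x 0) = 0 := by simp [worldFunction, hxA]
      rw [h5] at h2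
      have h6 : ‖gradient (worldFunction P.uCoeff xA N m) (x 0)‖ ^ 2 = 0 := by rw [h2]; ring
      simpa using h6)
    (fun ξ hξ => (hbd m hmI _ (hxK ξ hξ)).2.2.1.hasFDerivAt)
    (fun ξ hξ => (hbd m hmI _ (hxK ξ hξ)).2.2.2.2.2.2.2.2.1)
    (fun ξ hξ => (hbd m hmI _ (hxK ξ hξ)).2.2.2.2.2.2.2.2.2)
    hUb (fun ξ hξ => (hvb ξ hξ).trans (by rw [hL]; linarith))
    (fun ξ hξ => (hbd m hmI _ (hxK ξ hξ)).2.2.2.2.1.trans (by rw [hL]; linarith))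
    (fun ξ hξ => (hbd m hmI _ (hxK ξ hξ)).2.1.trans hCbm)
    (fun ξ hξ b => by
      have hb := hbd m hmI _ (hxK ξ hξ)
      have h2 := hb.2.2.2.1 b
      have h3 : ‖(P.potU m ‖x ξ‖ - 1) • b‖ ≤ Cb * m * ‖b‖ := by
        rw [norm_smul]
        gcongr
        exact hb.1
      have h4 := norm_sub_le (fderiv ℝ (gradient (worldFunction P.uCoeff xA N m)) (x ξ) b - b)
        ((P.potU m ‖x ξ‖ - 1) • b)
      have h5 : fderiv ℝ (gradient (worldFunction P.uCoeff xA N m)) (x ξ) b - P.potU m ‖x ξ‖ • b =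
          fderiv ℝ (gradient (worldFunction P.uCoeff xA N m)) (x ξ) b - b -
            (P.potU m ‖x ξ‖ - 1) • b := by module
      rw [h5]
      have h6 : 0 ≤ Cv * m * ‖b‖ := by positivity
      have h7 : C * m * ‖b‖ = Cb * m * ‖b‖ + Cb * m * ‖b‖ + Cv * m * ‖b‖ := by rw [hC]; ring
      linarith)
    (fun ξ hξ => by
      refine (hbd m hmI _ (hxK ξ hξ)).2.2.2.2.2.1.trans ?_
      calc Cb * ‖x ξ - xA‖ ≤ Cb * (2 * (R + 1) * ξ) := by gcongr; exact hxa ξ hξ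
        _ = Cb * (2 * (R + 1)) * ξ := by ring
        _ ≤ L * ξ := by
          have := hξ.1
          gcongr
          rw [hL]; linarith)
    (fun ξ hξ => by
      refine (hbd m hmI _ (hxK ξ hξ)).2.2.2.2.2.2.1.trans ?_
      calc Cb * ‖x ξ - xA‖ ≤ Cb * (2 * (R + 1) * ξ) := by gcongr; exact hxa ξ hξ
        _ = Cb * (2 * (R + 1)) * ξ := by ring
        _ ≤ L * ξ := by
          have := hξ.1
          gcongr
          rw [hL]; linarith)
  rw [hxB, worldFunction, ← hR] at hmain
  have hF := abs_le.1 (hxB ▸ (hbd m hmI _ (hxK 1 h1)).2.2.2.2.2.2.2.1)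
  set F := eikonalSum P.uCoeff xA N m xB
  have hF2 : 1 / 2 ≤ F := by linarith [hF.1]
  -- From `s ≥ -R / 2` and `F ≥ 1 / 2`. This lower bound allows passing from the difference of
  -- squares to that of `R + s` and `R F`, which gives the constant `62 L² / R`.
  have hsumpos : R ≤ R + s + R * F := by nlinarith [hle.1]
  have hprod : |R + s - R * F| * (R + s + R * F) =
      2 * |1 / 2 * (R + s) ^ 2 - 1 / 2 * R ^ 2 * F ^ 2| := by
    have h2 := congrArg abs (show (R + s - R * F) * (R + s + R * F) =
      2 * (1 / 2 * (R + s) ^ 2 - 1 / 2 * R ^ 2 * F ^ 2) by ring)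
    rwa [abs_mul, abs_mul, abs_of_nonneg (hRpos.le.trans hsumpos), abs_two] at h2
  have : |R + s - R * F| * R ≤ 62 * L ^ 2 * m ^ (N + 1) := by
    have := mul_le_mul_of_nonneg_left hsumpos (abs_nonneg (R + s - R * F))
    linarith
  rw [div_mul_eq_mul_div, le_div_iff₀ hRpos]
  exact this

/-- The terms of the expansion of the time of transfer solve the eikonal recurrence. -/
theorem IsQuasiMinkowskianRay.time_term_eq {P : PNParameters} {ρ : ℝ}
    (hreg : P.IsRegular ρ) {c tA : ℝ} {xA xB : E3} {D : Set E3} (hDo : IsOpen D)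
    (hD : StarConvex ℝ xA D) (hD0 : (0 : E3) ∉ D) (hB : xB ∈ D) (hBA : xB ≠ xA)
    {X0 : ℕ → ℝ → ℝ} {X : ℕ → ℝ → E3}
    (hray : IsQuasiMinkowskianRay P ρ c tA xA xB X0 X) (n : ℕ) :
    X0 (n + 1) 1 = ‖xB - xA‖ * eikonalTerm P.uCoeff xA (n + 1) xB := by
  induction n using Nat.strong_induction_on with
  | _ n ih =>
    -- Truncation at order `n + 1` leaves an error `m ^ (n + 2)`, one order beyond the coefficient
    -- sought; lower orders cancel by induction.
    obtain ⟨C, hC⟩ := hray.exists_abs_sub_le hreg hDo hD hD0 hB hBA (n + 1)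
    obtain ⟨m₀, Y, hm₀, H⟩ := hray.exists_momentum hreg
    obtain ⟨_, _, _, hs₀, -⟩ := H (m₀ / 2) (by linarith) (by linarith)
    obtain ⟨Cs, hCs, hs⟩ := exists_norm_sub_sum_le_of_hasSum (half_pos hm₀) hs₀.summable (n + 1)
    rw [← sub_eq_zero]
    have hpos : ∀ᶠ m in 𝓝[>] (0 : ℝ), 0 < m := self_mem_nhdsWithin
    refine eq_zero_of_norm_pow_smul_le (n := n + 1) (C := C + Cs) ?_
    filter_upwards [hC, hpos, eventually_mul_lt 1 (half_pos (half_pos hm₀))]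
      with m ⟨s, hsum, hsC⟩ hm hmm₀
    rw [one_mul] at hmm₀
    have hsm := hs m hm hmm₀.le s hsum
    rw [Real.norm_eq_abs] at hsm
    have heq : m ^ (n + 1) • (X0 (n + 1) 1 - ‖xB - xA‖ * eikonalTerm P.uCoeff xA (n + 1) xB) =
        (‖xB - xA‖ + s - ‖xB - xA‖ * eikonalSum P.uCoeff xA (n + 1) m xB) -
        (s - ∑ k ∈ Finset.range (n + 1), m ^ (k + 1) • X0 (k + 1) 1) := by
      rw [eikonalSum, Finset.sum_range_succ', eikonalTerm_zero, Finset.sum_range_succ,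
        Finset.sum_range_succ]
      have : ∑ k ∈ Finset.range n, m ^ (k + 1) • X0 (k + 1) 1 =
          ‖xB - xA‖ * ∑ k ∈ Finset.range n, m ^ (k + 1) * eikonalTerm P.uCoeff xA (k + 1) xB := by
        rw [Finset.mul_sum]
        refine Finset.sum_congr rfl fun k hk => ?_
        rw [ih k (Finset.mem_range.1 hk), smul_eq_mul]
        ring
      rw [this]
      simp only [smul_eq_mul]
      ring
    rw [heq, Real.norm_eq_abs, add_mul]
    exact (abs_sub _ _).trans (add_le_add hsC hsm)

end Rays

/-! ### Gradients of the transfer terms and the integrals of the recurrence. -/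

section TransferTerms

variable {P : PNParameters} {ρ c tA : ℝ} {xA : E3} {D : Set E3} {X0 : ℕ → E3 → ℝ → ℝ}
  {X : ℕ → E3 → ℝ → E3}

theorem timeTransferTerm_eq (hreg : P.IsRegular ρ) (hDo : IsOpen D) (hD : StarConvex ℝ xA D)
    (hD0 : (0 : E3) ∉ D)
    (hray : ∀ xB ∈ D, xB ≠ xA → IsQuasiMinkowskianRay P ρ c tA xA xB
      (fun n => X0 n xB) (fun n => X n xB)) (m : ℝ) {n : ℕ} (hn : 1 ≤ n) {x : E3} (hx : x ∈ D)
    (hxA : x ≠ xA) :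
    timeTransferTerm c m X0 n x =
      m ^ n / c * (‖x - xA‖ * eikonalTerm P.uCoeff xA n x) := by
  obtain ⟨k, rfl⟩ := Nat.exists_eq_succ_of_ne_zero (Nat.one_le_iff_ne_zero.1 hn)
  have h : X0 (k + 1) x 1 = _ := (hray x hx hxA).time_term_eq hreg hDo hD hD0 hx hxA k
  rw [timeTransferTerm, Nat.succ_eq_add_one, h]
  ring

theorem differentiableAt_norm_sub_mul_eikonalTerm (hDo : IsOpen D) (hD : StarConvex ℝ xA D)
    (hD0 : (0 : E3) ∉ D) (u : ℕ → ℝ) (n : ℕ) {x : E3} (hx : x ∈ D) (hxA : x ≠ xA) :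
    DifferentiableAt ℝ (fun y => ‖y - xA‖ * eikonalTerm u xA n y) x :=
  (hasFDerivAt_norm_sub hxA).differentiableAt.fun_mul
    (((contDiffOn_eikonalTerm hDo hD hD0 n).differentiableOn (by simp)).differentiableAt
      (hDo.mem_nhds hx))

/-- The source of all differentiability in the reception point: the rays are given point by point,
but their transfer terms agree with a smooth function near each `x ≠ xA`. -/
theorem timeTransferTerm_eventuallyEq (hreg : P.IsRegular ρ) (hDo : IsOpen D)
    (hD : StarConvex ℝ xA D) (hD0 : (0 : E3) ∉ D)
    (hray : ∀ xB ∈ D, xB ≠ xA → IsQuasiMinkowskianRay P ρ c tA xA xB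
      (fun n => X0 n xB) (fun n => X n xB)) (m : ℝ) {n : ℕ} (hn : 1 ≤ n) {x : E3} (hx : x ∈ D)
    (hxA : x ≠ xA) :
    timeTransferTerm c m X0 n =ᶠ[𝓝 x]
      fun y => m ^ n / c * (‖y - xA‖ * eikonalTerm P.uCoeff xA n y) := by
  filter_upwards [hDo.mem_nhds hx, isOpen_ne.mem_nhds hxA] with y hy hyA
  exact timeTransferTerm_eq hreg hDo hD hD0 hray m hn hy hyA

theorem inner_gradient_timeTransferTerm (hreg : P.IsRegular ρ) (hDo : IsOpen D)
    (hD : StarConvex ℝ xA D) (hD0 : (0 : E3) ∉ D)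
    (hray : ∀ xB ∈ D, xB ≠ xA → IsQuasiMinkowskianRay P ρ c tA xA xB
      (fun n => X0 n xB) (fun n => X n xB)) (m : ℝ) {p q : ℕ} (hp : 1 ≤ p) (hq : 1 ≤ q) {x : E3}
    (hx : x ∈ D) (hxA : x ≠ xA) :
    inner ℝ (gradient (timeTransferTerm c m X0 p) x) (gradient (timeTransferTerm c m X0 q) x) =
      m ^ (p + q) / c ^ 2 *
        eikonalProduct xA (eikonalTerm P.uCoeff xA p) (eikonalTerm P.uCoeff xA q) x := by
  have hdiff : ∀ n, DifferentiableAt ℝ (eikonalTerm P.uCoeff xA n) x := fun n =>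
    ((contDiffOn_eikonalTerm hDo hD hD0 n).differentiableOn (by simp)).differentiableAt
      (hDo.mem_nhds hx)
  have hg : ∀ n, 1 ≤ n → gradient (timeTransferTerm c m X0 n) x =
      (m ^ n / c) • gradient (fun y => ‖y - xA‖ * eikonalTerm P.uCoeff xA n y) x := by
    intro n hn
    have h1 := (differentiableAt_norm_sub_mul_eikonalTerm hDo hD hD0 P.uCoeff n hx
      hxA).hasFDerivAt.const_mul (m ^ n / c)
    refine gradient_eq_of_forall_inner (h1.congr_of_eventuallyEq
      (timeTransferTerm_eventuallyEq hreg hDo hD hD0 hray m hn hx hxA)) fun w => ?_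
    simp [inner_smul_left]
  rw [hg p hp, hg q hq, inner_smul_left, inner_smul_right,
    inner_gradient_norm_sub_mul hxA (hdiff p) (hdiff q)]
  simp only [RCLike.conj_to_real]
  ring

/-- The end `ξ = 0` is excluded because the gradients of the transfer terms are not controlled at
`xA`; a single point does not affect the integrals. -/
theorem seg_mem_and_ne (hD : StarConvex ℝ xA D) {xB : E3} (hB : xB ∈ D) (hBA : xB ≠ xA) {ξ : ℝ}
    (hξ : ξ ∈ Ioc (0 : ℝ) 1) : seg xA xB ξ ∈ D ∧ seg xA xB ξ ≠ xA := by
  refine ⟨starConvex_lineMap_mem hD hB ⟨hξ.1.le, hξ.2⟩, fun h => ?_⟩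
  simp only [seg, add_eq_left, smul_eq_zero, sub_eq_zero] at h
  rcases h with h | h
  exacts [hξ.1.ne' h, hBA h]

theorem continuousOn_comp_seg (hD : StarConvex ℝ xA D) {xB : E3} (hB : xB ∈ D) {f : E3 → ℝ}
    (hf : ContinuousOn f D) : ContinuousOn (fun ξ => f (seg xA xB ξ)) (uIcc 0 1) := by
  rw [uIcc_of_le zero_le_one]
  refine hf.comp ?_ fun ξ hξ => starConvex_lineMap_mem hD hB hξ
  unfold seg
  fun_prop

theorem intervalIntegrable_one_div_norm_seg_pow (hD : StarConvex ℝ xA D) (hD0 : (0 : E3) ∉ D)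
    {xB : E3} (hB : xB ∈ D) (n : ℕ) :
    IntervalIntegrable (fun ξ : ℝ => 1 / ‖seg xA xB ξ‖ ^ n) volume 0 1 := by
  refine (continuousOn_comp_seg (f := fun x => 1 / ‖x‖ ^ n) hD hB ?_).intervalIntegrable
  refine continuousOn_const.div (continuous_norm.pow n).continuousOn fun x hx => ?_
  exact pow_ne_zero _ (norm_ne_zero_iff.2 fun h0 => hD0 (h0 ▸ hx))

theorem intervalIntegrable_eikonalProduct_seg (hDo : IsOpen D) (hD : StarConvex ℝ xA D)
    (hD0 : (0 : E3) ∉ D) {xB : E3} (hB : xB ∈ D) (u : ℕ → ℝ) (p q : ℕ) :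
    IntervalIntegrable (fun ξ : ℝ =>
      eikonalProduct xA (eikonalTerm u xA p) (eikonalTerm u xA q) (seg xA xB ξ)) volume 0 1 :=
  (continuousOn_comp_seg hD hB (contDiffOn_eikonalProduct hDo (contDiffOn_eikonalTerm hDo hD hD0 p)
    (contDiffOn_eikonalTerm hDo hD hD0 q)).continuousOn).intervalIntegrable

theorem eikonalTerm_succ_eq_sum_integral (hDo : IsOpen D) (hD : StarConvex ℝ xA D)
    (hD0 : (0 : E3) ∉ D) {xB : E3} (hB : xB ∈ D) (u : ℕ → ℝ) (n : ℕ) :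
    eikonalTerm u xA (n + 1) xB =
      u (n + 1) / 2 * (∫ ξ in (0 : ℝ)..1, 1 / ‖seg xA xB ξ‖ ^ (n + 1)) -
      1 / 2 * ∑ p ∈ Finset.range n, ∫ ξ in (0 : ℝ)..1,
        eikonalProduct xA (eikonalTerm u xA (p + 1)) (eikonalTerm u xA (n - p)) (seg xA xB ξ) := by
  have hI : ∀ p ∈ Finset.range n, IntervalIntegrable (fun ξ : ℝ => eikonalProduct xA
      (eikonalTerm u xA (p + 1)) (eikonalTerm u xA (n - p)) (seg xA xB ξ)) volume 0 1 :=
    fun p _ => intervalIntegrable_eikonalProduct_seg hDo hD hD0 hB u _ _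
  have hJ := intervalIntegrable_one_div_norm_seg_pow hD hD0 hB (n + 1)
  have hS : IntervalIntegrable (fun ξ : ℝ => ∑ p ∈ Finset.range n, eikonalProduct xA
      (eikonalTerm u xA (p + 1)) (eikonalTerm u xA (n - p)) (seg xA xB ξ)) volume 0 1 := by
    simpa only [Finset.sum_fn] using IntervalIntegrable.sum _ hI
  rw [eikonalTerm_succ]
  change (∫ ξ in (0 : ℝ)..1, (u (n + 1) / 2 * (1 / ‖seg xA xB ξ‖ ^ (n + 1)) -
    1 / 2 * ∑ p ∈ Finset.range n, eikonalProduct xA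
      (eikonalTerm u xA (p + 1)) (eikonalTerm u xA (n - p)) (seg xA xB ξ))) = _
  rw [intervalIntegral.integral_sub (hJ.const_mul _) (hS.const_mul _),
    intervalIntegral.integral_const_mul, intervalIntegral.integral_const_mul,
    intervalIntegral.integral_finsetSum hI]

end TransferTerms

end TimeTransfer

end

/-! ### The recurrence for the transfer functions. -/

open TimeTransfer in
theorem proposition1 (P : TimeTransfer.PNParameters) (ρ : ℝ) (hreg : P.IsRegular ρ)
    (c : ℝ) (hc : 0 < c) (tA : ℝ) (xA : TimeTransfer.E3)
    (D : Set TimeTransfer.E3) (hDopen : IsOpen D) (hDstar : StarConvex ℝ xA D)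
    (hD0 : (0 : TimeTransfer.E3) ∉ D)
    (X0 : ℕ → TimeTransfer.E3 → ℝ → ℝ) (X : ℕ → TimeTransfer.E3 → ℝ → TimeTransfer.E3)
    (hray : ∀ xB ∈ D, xB ≠ xA → TimeTransfer.IsQuasiMinkowskianRay P ρ c tA xA xB
      (fun n => X0 n xB) (fun n => X n xB))
    (m : ℝ) (hm : 0 < m) :
    (∀ n : ℕ, 1 ≤ n → ∀ x ∈ D, x ≠ xA →
      DifferentiableAt ℝ (TimeTransfer.timeTransferTerm c m X0 n) x) ∧
    ∃ F : ℕ → TimeTransfer.E3 → ℝ, ∀ xB ∈ D, xB ≠ xA →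
      (∀ n : ℕ, 1 ≤ n →
        IntervalIntegrable (fun ξ : ℝ => 1 / ‖TimeTransfer.seg xA xB ξ‖ ^ n)
          MeasureTheory.volume 0 1) ∧
      (∀ p q : ℕ, 1 ≤ p → 1 ≤ q →
        IntervalIntegrable (fun ξ : ℝ => inner ℝ
          (gradient (TimeTransfer.timeTransferTerm c m X0 p) (TimeTransfer.seg xA xB ξ))
          (gradient (TimeTransfer.timeTransferTerm c m X0 q) (TimeTransfer.seg xA xB ξ)))
          MeasureTheory.volume 0 1) ∧
      (∀ n : ℕ, 1 ≤ n →
        TimeTransfer.timeTransferTerm c m X0 n xB = 1 / c * ‖xB - xA‖ * F n xB) ∧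
      F 1 xB = (1 + P.γ) * m * (∫ ξ in (0 : ℝ)..1, 1 / ‖TimeTransfer.seg xA xB ξ‖) ∧
      ∀ n : ℕ, 2 ≤ n →
        F n xB = P.kappa n * m ^ n * (∫ ξ in (0 : ℝ)..1, 1 / ‖TimeTransfer.seg xA xB ξ‖ ^ n)
          - c ^ 2 / 2 * ∑ p ∈ Finset.Icc 1 (n - 1), ∫ ξ in (0 : ℝ)..1, inner ℝ
            (gradient (TimeTransfer.timeTransferTerm c m X0 p) (TimeTransfer.seg xA xB ξ))
            (gradient (TimeTransfer.timeTransferTerm c m X0 (n - p))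
              (TimeTransfer.seg xA xB ξ)) := by
  -- The witness restores the power of `m`. Each product of two gradients carries `1 / c ^ 2`, which
  -- cancels the prefactor `c ^ 2 / 2` down to the `1 / 2` in the recurrence for `eikonalTerm`.
  refine ⟨fun n hn x hx hxA => ?_, fun n x => m ^ n * eikonalTerm P.uCoeff xA n x,
    fun xB hB hBA => ⟨fun n _ => intervalIntegrable_one_div_norm_seg_pow hDstar hD0 hB n,
      fun p q hp hq => ?_, fun n hn => ?_, ?_, fun n hn => ?_⟩⟩
  · exact ((differentiableAt_norm_sub_mul_eikonalTerm hDopen hDstar hD0 P.uCoeff n hx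
      hxA).const_mul _).congr_of_eventuallyEq
      (timeTransferTerm_eventuallyEq hreg hDopen hDstar hD0 hray m hn hx hxA)
  · refine ((intervalIntegrable_eikonalProduct_seg hDopen hDstar hD0 hB P.uCoeff p q).const_mul
      (m ^ (p + q) / c ^ 2)).congr fun ξ hξ => ?_
    rw [Set.uIoc_of_le zero_le_one] at hξ
    obtain ⟨h1, h2⟩ := seg_mem_and_ne hDstar hB hBA hξ
    exact (inner_gradient_timeTransferTerm hreg hDopen hDstar hD0 hray m hp hq h1 h2).symm
  · rw [timeTransferTerm_eq hreg hDopen hDstar hD0 hray m hn hB hBA]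
    ring
  · simp only [eikonalTerm_succ_eq_sum_integral hDopen hDstar hD0 hB P.uCoeff 0, zero_add,
      P.uCoeff_one, Finset.range_zero, Finset.sum_empty, pow_one]
    ring
  · obtain ⟨k, rfl⟩ := Nat.exists_eq_add_of_le' (one_le_two.trans hn)
    have hint : ∀ p ∈ Finset.range k, (∫ ξ in (0 : ℝ)..1, inner ℝ
        (gradient (timeTransferTerm c m X0 (p + 1)) (seg xA xB ξ))
        (gradient (timeTransferTerm c m X0 (k - p)) (seg xA xB ξ))) =
        m ^ (k + 1) / c ^ 2 * ∫ ξ in (0 : ℝ)..1, eikonalProduct xA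
          (eikonalTerm P.uCoeff xA (p + 1)) (eikonalTerm P.uCoeff xA (k - p)) (seg xA xB ξ) := by
      intro p hp
      have hpk := Finset.mem_range.1 hp
      rw [← intervalIntegral.integral_const_mul]
      refine intervalIntegral.integral_congr_ae (MeasureTheory.ae_of_all _ fun ξ hξ => ?_)
      rw [Set.uIoc_of_le zero_le_one] at hξ
      obtain ⟨h1, h2⟩ := seg_mem_and_ne hDstar hB hBA hξ
      rw [inner_gradient_timeTransferTerm hreg hDopen hDstar hD0 hray m (by omega) (by omega) h1 h2]
      congr 3
      omega
    have hsum : ∑ p ∈ Finset.Icc 1 (k + 1 - 1), (∫ ξ in (0 : ℝ)..1, inner ℝ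
        (gradient (timeTransferTerm c m X0 p) (seg xA xB ξ))
        (gradient (timeTransferTerm c m X0 (k + 1 - p)) (seg xA xB ξ))) =
        m ^ (k + 1) / c ^ 2 * ∑ p ∈ Finset.range k, ∫ ξ in (0 : ℝ)..1, eikonalProduct xA
          (eikonalTerm P.uCoeff xA (p + 1)) (eikonalTerm P.uCoeff xA (k - p)) (seg xA xB ξ) := by
      rw [Finset.mul_sum, ← Finset.sum_congr rfl hint]
      refine Finset.sum_nbij' (· - 1) (· + 1) ?_ ?_ ?_ ?_ fun p hp => ?_
      · intro p hp; simp at hp ⊢; omega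
      · intro p hp; simp at hp ⊢; omega
      · intro p hp; simp at hp ⊢; omega
      · intro p hp; simp
      · have hp' := Finset.mem_Icc.1 hp
        rw [Nat.sub_add_cancel hp'.1, show k - (p - 1) = k + 1 - p by omega]
    simp only [eikonalTerm_succ_eq_sum_integral hDopen hDstar hD0 hB P.uCoeff k]
    rw [hsum, P.kappa_eq]
    field_simp
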